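/- Let $\Sigma$ be a rational pointed fan in $\mathbb R^d$, i.e. a finite collection of rational pointed (strongly convex polyhedral) cones such that, for $C'\subseteq C$ with $C\in\Sigma$, $C'$ is a face of $C$ if and only if $C'\in\Sigma$, and such that $C\cap C'$ is a common face of $C$ and $C'$ for all $C,C'\in\Sigma$. Let $K$ be a field. The toric face ring $K[\Sigma]$ is the $K$-vector space with basis the monomials $x^a$, $a\in\bigcup_{C\in\Sigma}C\cap\mathbb Z^d$, with multiplication $x^a\cdot x^b=x^{a+b}$ if $a,b$ lie in a common cone of $\Sigma$ and $x^a\cdot x^b=0$ otherwise. A ring $R$ is called clean if it has a finite filtration $0=M_0\subset M_1\subset\dots\subset M_r=R$ by ideals with $M_i/M_{i-1}\cong R/P_i$ as $R$-modules for prime ideals $P_i$ such that $\{P_1,\dots,P_r\}=\operatorname{Min}(\operatorname{Supp} R)$, the set of minimal primes of $R$. For a cone $C$ let $\operatorname{fan}(C)$ be the set of faces of $C$ and $\operatorname{fan}(\partial C)$ the set of proper faces of $C$. For a fan $\Sigma$ and $a\in\mathbb Z^d$ let $\operatorname{star}_\Sigma(a)=\{D\in\Sigma: a\in D\}$. A (non-pure)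 shelling of a fan $\Sigma$ is a linear ordering $C_1,\dots,C_s$ of the facets (maximal cones) of $\Sigma$ such that either $\dim\Sigma=0$, or $\operatorname{fan}(\partial C_1)$ has a shelling and for every $1<j\le s$ there is a shelling $D_1,\dots,D_{t_j}$ of $\operatorname{fan}(\partial C_j)$ with $$\emptyset\ne\bigcup_{i=1}^{j-1}\operatorname{fan}(C_i)\cap\operatorname{fan}(C_j)=\bigcup_{l=1}^{r_j}\operatorname{fan}(D_l)\quad\text{for some }1\le r_j\le t_j.$$ Then $K[\Sigma]$ is clean if and only if the following conditions are satisfied: (i) $\Sigma$ is shellable with some shelling $C_1,\dots,C_s$; (ii) for this shelling and every $1<j\le s$ there exists $\gamma_j\in C_j\cap\mathbb Z^d$ such that (a) $\operatorname{star}_{\operatorname{fan}(C_j)}(\gamma_j)=\operatorname{fan}(C_j)\setminus\bigcup_{i=1}^{j-1}\operatorname{fan}(C_i)$, and (b) $\bigcup_{D\in\operatorname{star}_{\operatorname{fan}(C_j)}(\gamma_j)}\operatorname{relint}(D)\cap\mathbb Z^d=\gamma_j+(C_j\cap\mathbb Z^d)$. In particular, cleanness does not depend on $K$ (hence not on $\operatorname{char}K$):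 for any two fields $K$ and $L$, $K[\Sigma]$ is clean if and only if $L[\Sigma]$ is clean. -/

import Mathlib

/-- The inclusion `ℤ^d ⊆ ℝ^d`. -/
def latticeVec {d : ℕ} (a : Fin d → ℤ) : Fin d → ℝ := fun i => (a i : ℝ)

/-- Convex cones in `ℝ^d` with apex `0`. -/
abbrev RCone (d : ℕ) := PointedCone ℝ (Fin d → ℝ)

namespace RCone

variable {d : ℕ}

/-- A cone is rational if it is generated by finitely many lattice vectors. -/
def IsRational (C : RCone d) : Prop :=
  ∃ s : Finset (Fin d → ℤ), C = PointedCone.hull ℝ (latticeVec '' (s : Set (Fin d → ℤ)))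

/-- A cone is pointed (strongly convex) if it contains no line. In Mathlib this is called
`Salient`; there, "pointed" just means that the cone contains `0`. -/
def IsStronglyConvex (C : RCone d) : Prop := (C : ConvexCone ℝ (Fin d → ℝ)).Salient

/-- The set `C ∩ ℤ^d`. -/
def latticePoints (C : RCone d) : Set (Fin d → ℤ) := {a | latticeVec a ∈ C}

/-- The set `relint(C) ∩ ℤ^d`. -/
def relintLatticePoints (C : RCone d) : Set (Fin d → ℤ) :=
  {a | latticeVec a ∈ intrinsicInterior ℝ (C : Set (Fin d → ℝ))}

/-- `fan(C)`, the set of faces of `C`. -/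
def fan (C : RCone d) : Set (RCone d) := {D | D.IsFaceOf C}

/-- `fan(∂C)`, the set of faces of the boundary of `C`, i.e. of proper faces of `C`. -/
def boundaryFan (C : RCone d) : Set (RCone d) := {D | D.IsFaceOf C ∧ D ≠ C}

/-- The dimension of a cone. -/
noncomputable def dim (C : RCone d) : ℕ :=
  Module.finrank ℝ (Submodule.span ℝ (C : Set (Fin d → ℝ)))

end RCone

/-- The dimension of a collection of cones in `ℝ^d`, the maximal dimension of a member. -/
noncomputable def fanDim {d : ℕ} (S : Set (RCone d)) : ℕ := sSup (RCone.dim '' S)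

/-- The star of a lattice point in a collection of cones. -/
def latticeStar {d : ℕ} (S : Set (RCone d)) (a : Fin d → ℤ) : Set (RCone d) :=
  {D | D ∈ S ∧ latticeVec a ∈ D}

/-- `C_1, …, C_s` is a linear ordering (without repetition) of the facets, i.e. of the maximal
members, of `S`. -/
def IsFacetOrdering {d : ℕ} (S : Set (RCone d)) {s : ℕ} (C : Fin s → RCone d) : Prop :=
  Function.Injective C ∧ ∀ D, D ∈ Set.range C ↔ Maximal (· ∈ S) D

/-- (Non-pure) shellings. In `step`, the list `D j` is a shelling of `fan(∂C_j)`, and for every `j`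
other than the first, an initial segment of it describes
`⋃_{i < j} fan(C_i) ∩ fan(C_j)`. -/
inductive IsShelling {d : ℕ} : Set (RCone d) → {s : ℕ} → (Fin s → RCone d) → Prop
  | dim_zero {S : Set (RCone d)} {s : ℕ} {C : Fin s → RCone d}
      (facets : IsFacetOrdering S C) (dim_eq : fanDim S = 0) : IsShelling S C
  | step {S : Set (RCone d)} {s : ℕ} {C : Fin s → RCone d}
      (facets : IsFacetOrdering S C)
      (t : Fin s → ℕ) (D : (j : Fin s) → Fin (t j) → RCone d)
      (shelling : ∀ j, IsShelling (RCone.boundaryFan (C j)) (D j))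
      (inter : ∀ j : Fin s, 0 < (j : ℕ) →
        (⋃ i : Fin s, ⋃ _ : i < j, (C i).fan ∩ (C j).fan).Nonempty ∧
        ∃ r : ℕ, 1 ≤ r ∧ r ≤ t j ∧
          (⋃ i : Fin s, ⋃ _ : i < j, (C i).fan ∩ (C j).fan) =
            ⋃ l : Fin (t j), ⋃ _ : (l : ℕ) < r, (D j l).fan) : IsShelling S C

/-- A rational pointed fan in `ℝ^d`. -/
structure RationalPointedFan (d : ℕ) where
  /-- The cones of the fan. -/
  cones : Set (RCone d)
  finite : cones.Finite
  rational : ∀ C ∈ cones, C.IsRational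
  pointed : ∀ C ∈ cones, C.IsStronglyConvex
  face_iff : ∀ C ∈ cones, ∀ C' ≤ C, PointedCone.IsFaceOf C' C ↔ C' ∈ cones
  inter_face : ∀ C ∈ cones, ∀ C' ∈ cones,
    PointedCone.IsFaceOf (C ⊓ C') C ∧ PointedCone.IsFaceOf (C ⊓ C') C'

namespace RationalPointedFan

variable {d : ℕ}

/-- The lattice points in the support of a fan, the set `⋃_{C} C ∩ ℤ^d`. -/
def latticePoints (S : RationalPointedFan d) : Set (Fin d → ℤ) :=
  {a | ∃ C ∈ S.cones, a ∈ C.latticePoints}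

/-- `a` and `b` lie in a common cone of the fan. -/
def InCommonCone (S : RationalPointedFan d) (a b : Fin d → ℤ) : Prop :=
  ∃ C ∈ S.cones, a ∈ C.latticePoints ∧ b ∈ C.latticePoints

theorem latticeVec_add (a b : Fin d → ℤ) :
    latticeVec (a + b) = latticeVec a + latticeVec b := by
  funext i; simp [latticeVec]

theorem latticeVec_zero : latticeVec (0 : Fin d → ℤ) = 0 := by
  funext i; simp [latticeVec]

theorem InCommonCone.add_mem {S : RationalPointedFan d} {a b : Fin d → ℤ}
    (h : S.InCommonCone a b) : a + b ∈ S.latticePoints := by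
  obtain ⟨C, hC, ha, hb⟩ := h
  refine ⟨C, hC, ?_⟩
  change latticeVec (a + b) ∈ C
  rw [latticeVec_add]
  exact Submodule.add_mem C ha hb

theorem inCommonCone_comm {S : RationalPointedFan d} {a b : Fin d → ℤ} :
    S.InCommonCone a b ↔ S.InCommonCone b a :=
  ⟨fun ⟨C, hC, ha, hb⟩ => ⟨C, hC, hb, ha⟩, fun ⟨C, hC, ha, hb⟩ => ⟨C, hC, hb, ha⟩⟩

/-- A triple of lattice points in a common cone, described in steps. -/
theorem inCommonCone_add_iff {S : RationalPointedFan d} {a b c : Fin d → ℤ} :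
    (S.InCommonCone a b ∧ S.InCommonCone (a + b) c) ↔
      ∃ C ∈ S.cones, a ∈ C.latticePoints ∧ b ∈ C.latticePoints ∧ c ∈ C.latticePoints := by
  constructor
  · rintro ⟨⟨C, hC, ha, hb⟩, ⟨C', hC', hab, hc⟩⟩
    change latticeVec (a + b) ∈ C' at hab
    rw [latticeVec_add] at hab
    have hF := (S.inter_face C hC C' hC').1
    have hmem : latticeVec a + latticeVec b ∈ C ⊓ C' :=
      ⟨Submodule.add_mem C ha hb, hab⟩
    exact ⟨C', hC', (hF.mem_of_add_mem_left ha hb hmem).2,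
      (hF.mem_of_add_mem_right ha hb hmem).2, hc⟩
  · rintro ⟨C, hC, ha, hb, hc⟩
    refine ⟨⟨C, hC, ha, hb⟩, ⟨C, hC, ?_, hc⟩⟩
    change latticeVec (a + b) ∈ C
    rw [latticeVec_add]
    exact Submodule.add_mem C ha hb

end RationalPointedFan

/-- The toric face ring `K[Σ]`: the `K`-vector space with basis the monomials `x^a` for the
lattice points `a` of the fan. -/
def ToricFaceRing {d : ℕ} (K : Type*) [Field K] (S : RationalPointedFan d) : Type _ :=
  S.latticePoints →₀ K

namespace ToricFaceRing

variable {d : ℕ} {K : Type*} [Field K] {S : RationalPointedFan d}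

noncomputable instance : AddCommGroup (ToricFaceRing K S) :=
  inferInstanceAs (AddCommGroup (S.latticePoints →₀ K))

noncomputable instance : Module K (ToricFaceRing K S) :=
  inferInstanceAs (Module K (S.latticePoints →₀ K))

/-- The monomial `x^a`. -/
noncomputable def monomial (a : S.latticePoints) : ToricFaceRing K S :=
  (Finsupp.single a 1 : S.latticePoints →₀ K)

/-- The linear map that sends `x^a` to `v a`. -/
noncomputable def extend {M : Type*} [AddCommGroup M] [Module K M] (v : S.latticePoints → M) :
    ToricFaceRing K S →ₗ[K] M :=
  (Finsupp.linearCombination K v : (S.latticePoints →₀ K) →ₗ[K] M)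

theorem extend_monomial {M : Type*} [AddCommGroup M] [Module K M] (v : S.latticePoints → M)
    (a : S.latticePoints) : extend (K := K) v (monomial a) = v a :=
  (Finsupp.linearCombination_single K 1 a).trans (one_smul K (v a))

theorem hom_ext {M : Type*} [AddCommGroup M] [Module K M] {f g : ToricFaceRing K S →ₗ[K] M}
    (h : ∀ a, f (monomial a) = g (monomial a)) : f = g := by
  apply Finsupp.lhom_ext'
  intro a
  apply LinearMap.ext_ring
  exact h a

open Classical in
/-- The product of two monomials: `x^(a+b)` if `a`, `b` lie in a common cone and `0` otherwise. -/
noncomputable def monomialMul (a b : S.latticePoints) : ToricFaceRing K S :=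
  if h : S.InCommonCone a b then monomial ⟨a.1 + b.1, h.add_mem⟩ else 0

/-- The bilinear extension of the multiplication of monomials. -/
noncomputable def mulLin : ToricFaceRing K S →ₗ[K] ToricFaceRing K S →ₗ[K] ToricFaceRing K S :=
  extend fun a => extend (monomialMul a)

noncomputable instance : Mul (ToricFaceRing K S) := ⟨fun f g => mulLin f g⟩

open Classical in
/-- The unit is `x^0` (and is `0` in the zero ring of the empty fan). -/
noncomputable instance : One (ToricFaceRing K S) :=
  ⟨if h : (0 : Fin d → ℤ) ∈ S.latticePoints then monomial ⟨0, h⟩ else 0⟩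

theorem mul_def (f g : ToricFaceRing K S) : f * g = mulLin f g := rfl

open Classical in
theorem monomial_mul_monomial (a b : S.latticePoints) :
    (monomial a * monomial b : ToricFaceRing K S) =
      if h : S.InCommonCone a b then monomial ⟨a.1 + b.1, h.add_mem⟩ else 0 := by
  simp only [mul_def, mulLin, extend_monomial, monomialMul]

theorem monomial_mul_comm (a b : S.latticePoints) :
    (monomial a * monomial b : ToricFaceRing K S) = monomial b * monomial a := by
  rw [monomial_mul_monomial, monomial_mul_monomial]
  by_cases h : S.InCommonCone a b
  · rw [dif_pos h, dif_pos (RationalPointedFan.inCommonCone_comm.1 h)]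
    congr 1
    exact Subtype.ext (add_comm _ _)
  · rw [dif_neg h, dif_neg (fun h' => h (RationalPointedFan.inCommonCone_comm.1 h'))]

theorem mul_comm' (f g : ToricFaceRing K S) : f * g = g * f := by
  have h : (mulLin : ToricFaceRing K S →ₗ[K] _) = mulLin.flip := by
    refine hom_ext fun a => hom_ext fun b => ?_
    exact monomial_mul_comm a b
  exact LinearMap.congr_fun (LinearMap.congr_fun h f) g

open Classical in
theorem monomial_mul_mul (a b c : S.latticePoints) :
    (monomial a * monomial b * monomial c : ToricFaceRing K S) =
      if h : ∃ C ∈ S.cones, (a : Fin d → ℤ) ∈ C.latticePoints ∧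
          (b : Fin d → ℤ) ∈ C.latticePoints ∧ (c : Fin d → ℤ) ∈ C.latticePoints then
        monomial ⟨a.1 + b.1 + c.1, (RationalPointedFan.inCommonCone_add_iff.2 h).2.add_mem⟩
      else 0 := by
  rw [monomial_mul_monomial]
  by_cases h1 : S.InCommonCone a b
  · rw [dif_pos h1, monomial_mul_monomial]
    by_cases h2 : S.InCommonCone (a + b) c
    · rw [dif_pos h2, dif_pos (RationalPointedFan.inCommonCone_add_iff.1 ⟨h1, h2⟩)]
    · rw [dif_neg h2, dif_neg fun h => h2 (RationalPointedFan.inCommonCone_add_iff.2 h).2]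
  · rw [dif_neg h1, dif_neg fun h => h1 (RationalPointedFan.inCommonCone_add_iff.2 h).1]
    simp [mul_def]

theorem monomial_mul_assoc (a b c : S.latticePoints) :
    (monomial a * monomial b * monomial c : ToricFaceRing K S) =
      monomial a * (monomial b * monomial c) := by
  rw [mul_comm' (monomial a) (monomial b * monomial c), monomial_mul_mul, monomial_mul_mul]
  by_cases h : ∃ C ∈ S.cones, (a : Fin d → ℤ) ∈ C.latticePoints ∧
          (b : Fin d → ℤ) ∈ C.latticePoints ∧ (c : Fin d → ℤ) ∈ C.latticePoints
  · have h' : ∃ C ∈ S.cones, (b : Fin d → ℤ) ∈ C.latticePoints ∧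
          (c : Fin d → ℤ) ∈ C.latticePoints ∧ (a : Fin d → ℤ) ∈ C.latticePoints := by
      obtain ⟨C, hC, ha, hb, hc⟩ := h
      exact ⟨C, hC, hb, hc, ha⟩
    rw [dif_pos h, dif_pos h']
    congr 1
    apply Subtype.ext
    change (a : Fin d → ℤ) + b + c = b + c + a
    abel
  · rw [dif_neg h, dif_neg]
    rintro ⟨C, hC, hb, hc, ha⟩
    exact h ⟨C, hC, ha, hb, hc⟩

theorem mul_assoc' (f g k : ToricFaceRing K S) : f * g * k = f * (g * k) := by
  have h1 (a b : S.latticePoints) : mulLin (monomial a * monomial b) =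
      (mulLin (monomial a)).comp (mulLin (K := K) (monomial b)) :=
    hom_ext fun c => monomial_mul_assoc a b c
  have h2 (a : S.latticePoints) : (mulLin.flip k).comp (mulLin (monomial a)) =
      (mulLin (monomial a)).comp (mulLin.flip k) :=
    hom_ext fun b => LinearMap.congr_fun (h1 a b) k
  have h3 : (mulLin.flip k).comp (mulLin.flip g) = mulLin.flip (g * k) :=
    hom_ext fun a => LinearMap.congr_fun (h2 a) g
  exact LinearMap.congr_fun h3 f

theorem one_mul' (f : ToricFaceRing K S) : 1 * f = f := by
  have h : (mulLin (1 : ToricFaceRing K S)) = LinearMap.id := by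
    refine hom_ext fun b => ?_
    obtain ⟨b, C, hC, hb⟩ := b
    have h0 : (0 : Fin d → ℤ) ∈ C.latticePoints := by
      change latticeVec 0 ∈ C
      rw [RationalPointedFan.latticeVec_zero]
      exact Submodule.zero_mem C
    have h1 : (1 : ToricFaceRing K S) = monomial ⟨0, C, hC, h0⟩ :=
      dif_pos (⟨C, hC, h0⟩ : (0 : Fin d → ℤ) ∈ S.latticePoints)
    rw [← mul_def, h1, monomial_mul_monomial, dif_pos ⟨C, hC, h0, hb⟩, LinearMap.id_apply]
    congr 1
    exact Subtype.ext (zero_add b)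
  exact LinearMap.congr_fun h f

noncomputable instance : CommRing (ToricFaceRing K S) where
  __ := (inferInstance : AddCommGroup (ToricFaceRing K S))
  left_distrib f g k := by simp [mul_def]
  right_distrib f g k := by simp [mul_def]
  zero_mul f := by simp [mul_def]
  mul_zero f := by simp [mul_def]
  mul_assoc := mul_assoc'
  one_mul := one_mul'
  mul_one f := by rw [mul_comm', one_mul']
  mul_comm := mul_comm'

end ToricFaceRing

/-- `M` has a clean filtration: a filtration `0 = M_0 ⊆ ⋯ ⊆ M_r = M` with
`M_i / M_{i-1} ≅ R / P_i` for primes `P_i` (so that the inclusions are strict), such that the set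
of the `P_i` is the set of minimal elements of `Supp M`. -/
def IsCleanModule (R M : Type*) [CommRing R] [AddCommGroup M] [Module R M] : Prop :=
  ∃ (r : ℕ) (N : Fin (r + 1) → Submodule R M) (P : Fin r → PrimeSpectrum R),
    N 0 = ⊥ ∧ N (Fin.last r) = ⊤ ∧
    (∀ i : Fin r, N i.castSucc ≤ N i.succ ∧
      Nonempty ((N i.succ ⧸ (N i.castSucc).submoduleOf (N i.succ)) ≃ₗ[R]
        (R ⧸ (P i).asIdeal))) ∧
    Set.range P = {p | Minimal (· ∈ Module.support R M) p}

/-- A ring is clean if it is clean as a module over itself. -/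
def IsCleanRing (R : Type*) [CommRing R] : Prop := IsCleanModule R R

/-
In a reduced ring the members of a clean filtration, read from the top, are the intersections
`P₁ ∩ ⋯ ∩ Pⱼ` of the minimal primes. So the ring is clean if and only if its minimal primes can be
ordered in such a way that, for every `j`, the ideal `P₁ ∩ ⋯ ∩ Pⱼ₋₁` is generated by one element
modulo `P₁ ∩ ⋯ ∩ Pⱼ`.

The minimal primes of `K[Σ]` belong to the facets, and for an ordering `C₁, …, Cₛ` of the facets
the quotient `(P₁ ∩ ⋯ ∩ Pⱼ₋₁) / (P₁ ∩ ⋯ ∩ Pⱼ)` is the ideal of `K[Cⱼ]` spanned by the monomials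
`x^a` with `a ∈ Cⱼ ∩ ℤ^d` in none of the earlier facets. As the divisors of a monomial in the
Laurent polynomial ring are monomials, this ideal is principal if and only if these `a` form the
set `γⱼ + (Cⱼ ∩ ℤ^d)` for some `γⱼ`, which is condition (ii).

The shelling then comes for free. The faces of `Cⱼ` that are faces of an earlier facet are those
which do not contain `γⱼ`, that is, the faces visible from `-γⱼ`. A line shelling of the boundary of
`Cⱼ`, in the manner of Bruggesser and Mani, can be chosen so that it starts with the facets visible
from a given point.
-/

/-! ### Polyhedral cones -/

open Filter Topology

section HalfspaceCone

variable {𝕜 E : Type*} [Field 𝕜] [LinearOrder 𝕜] [IsStrictOrderedRing 𝕜]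
  [AddCommGroup E] [Module 𝕜 E]

theorem eventually_mul_add_pos {a : 𝕜} (ha : 0 < a) (b : 𝕜) : ∀ᶠ t in atTop, 0 < t * a + b :=
  (tendsto_atTop_add_const_right _ b (tendsto_id.atTop_mul_const ha)).eventually_gt_atTop 0

theorem eventually_mul_add_neg {a : 𝕜} (ha : a < 0) (b : 𝕜) : ∀ᶠ t in atTop, t * a + b < 0 := by
  filter_upwards [eventually_mul_add_pos (neg_pos.2 ha) (-b)] with t ht
  linarith

theorem eventually_mul_add_ne_zero (a : 𝕜) {b : 𝕜} (hb : b ≠ 0) :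
    ∀ᶠ t in atTop, t * a + b ≠ 0 := by
  rcases lt_trichotomy a 0 with ha | rfl | ha
  · exact (eventually_mul_add_neg ha b).mono fun _ => ne_of_lt
  · exact .of_forall fun t => by rwa [mul_zero, zero_add]
  · exact (eventually_mul_add_pos ha b).mono fun _ => ne_of_gt

/-- The polyhedral cone of the points of `V` at which all functionals in `I` are nonnegative. The
subspace `V` is kept apart from `I` so that the cone can have nonempty interior in `V`. -/
def halfspaceCone (V : Submodule 𝕜 E) (I : Finset (Module.Dual 𝕜 E)) : PointedCone 𝕜 E where
  carrier := {x | x ∈ V ∧ ∀ l ∈ I, 0 ≤ l x}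
  add_mem' hx hy := ⟨V.add_mem hx.1 hy.1, fun l hl => by
    rw [map_add]; exact add_nonneg (hx.2 l hl) (hy.2 l hl)⟩
  zero_mem' := ⟨V.zero_mem, fun l _ => (map_zero l).ge⟩
  smul_mem' c x hx := ⟨V.smul_mem (c : 𝕜) hx.1, fun l hl => by
    change 0 ≤ l ((c : 𝕜) • x)
    rw [map_smul]; exact mul_nonneg c.2 (hx.2 l hl)⟩

variable {V : Submodule 𝕜 E} {I : Finset (Module.Dual 𝕜 E)}

theorem mem_halfspaceCone {x : E} : x ∈ halfspaceCone V I ↔ x ∈ V ∧ ∀ l ∈ I, 0 ≤ l x := Iff.rfl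

theorem halfspaceCone_anti {J : Finset (Module.Dual 𝕜 E)} (h : J ⊆ I) :
    halfspaceCone V I ≤ halfspaceCone V J := fun _ hx => ⟨hx.1, fun l hl => hx.2 l (h hl)⟩

theorem exists_nonneg_forall_mul_le_iff {ι : Type*} (I : Finset ι) (a b : ι → 𝕜) :
    (∃ t, 0 ≤ t ∧ ∀ i ∈ I, t * b i ≤ a i) ↔ (∀ i ∈ I, 0 ≤ b i → 0 ≤ a i) ∧
      ∀ i ∈ I, ∀ j ∈ I, b i < 0 → 0 < b j → b i * a j ≤ b j * a i := by
  classical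
  constructor
  · rintro ⟨t, ht, h⟩
    refine ⟨fun i hi hb => (mul_nonneg ht hb).trans (h i hi), fun i hi j hj hbi hbj => ?_⟩
    calc b i * a j ≤ b i * (t * b j) := mul_le_mul_of_nonpos_left (h j hj) hbi.le
      _ = b j * (t * b i) := by ring
      _ ≤ b j * a i := mul_le_mul_of_nonneg_left (h i hi) hbj.le
  · rintro ⟨h_nonneg, h⟩
    obtain ⟨t, ht, hmax⟩ := (insert 0 ((I.filter (b · < 0)).image fun i => a i / b i))
      |>.exists_max_image id ⟨0, Finset.mem_insert_self _ _⟩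
    refine ⟨t, hmax 0 (Finset.mem_insert_self _ _), fun j hj => ?_⟩
    rcases lt_trichotomy (b j) 0 with hbj | hbj | hbj
    · exact (div_le_iff_of_neg hbj).1 (hmax _ (Finset.mem_insert_of_mem
        (Finset.mem_image_of_mem _ (Finset.mem_filter.2 ⟨hj, hbj⟩))))
    · rw [hbj, mul_zero]
      exact h_nonneg j hj hbj.ge
    · obtain rfl | ht := Finset.mem_insert.1 ht
      · rw [zero_mul]
        exact h_nonneg j hj hbj.le
      · obtain ⟨i, hi, rfl⟩ := Finset.mem_image.1 ht
        obtain ⟨hi, hbi⟩ := Finset.mem_filter.1 hi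
        rw [div_mul_eq_mul_div, div_le_iff_of_neg hbi]
        linarith [h i hi j hj hbi hbj]

theorem exists_halfspaceCone_sup_ray (I : Finset (Module.Dual 𝕜 E)) (v : E) :
    ∃ J : Finset (Module.Dual 𝕜 E), ∀ x, x ∈ halfspaceCone ⊤ J ↔
      ∃ t : 𝕜, 0 ≤ t ∧ x - t • v ∈ halfspaceCone ⊤ I := by
  classical
  -- Fourier–Motzkin elimination of `t`
  refine ⟨I.filter (0 ≤ · v) ∪ ((I ×ˢ I).filter fun q => q.1 v < 0 ∧ 0 < q.2 v).image
    fun q => q.2 v • q.1 - q.1 v • q.2, fun x => ?_⟩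
  simp only [mem_halfspaceCone, Submodule.mem_top, true_and, map_sub, map_smul, smul_eq_mul,
    sub_nonneg, exists_nonneg_forall_mul_le_iff, Finset.forall_mem_union, Finset.forall_mem_image,
    Finset.mem_filter, Finset.mem_product, LinearMap.sub_apply, LinearMap.smul_apply, and_imp,
    Prod.forall]
  exact and_congr_right fun _ => ⟨fun h i hi j hj => h i j hi hj, fun h i j hi hj => h i hi j hj⟩

theorem exists_halfspaceCone_eq_bot [FiniteDimensional 𝕜 E] :
    ∃ J : Finset (Module.Dual 𝕜 E), halfspaceCone ⊤ J = ⊥ := by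
  classical
  let b := Module.finBasis 𝕜 E
  refine ⟨Finset.univ.image b.coord ∪ Finset.univ.image fun i => -b.coord i,
    (eq_bot_iff).2 fun x hx => b.forall_coord_eq_zero_iff.1 fun i => le_antisymm ?_ ?_⟩
  · have := hx.2 (-b.coord i) (Finset.mem_union_right _ (Finset.mem_image_of_mem _ (by simp)))
    rwa [LinearMap.neg_apply, neg_nonneg] at this
  · exact hx.2 _ (Finset.mem_union_left _ (Finset.mem_image_of_mem _ (Finset.mem_univ i)))

theorem exists_halfspaceCone_eq_hull [FiniteDimensional 𝕜 E] (s : Finset E) :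
    ∃ J : Finset (Module.Dual 𝕜 E), halfspaceCone ⊤ J = PointedCone.hull 𝕜 (s : Set E) := by
  classical
  induction s using Finset.induction_on with
  | empty =>
    obtain ⟨J, hJ⟩ := exists_halfspaceCone_eq_bot (𝕜 := 𝕜) (E := E)
    exact ⟨J, by rw [hJ, Finset.coe_empty, PointedCone.hull, Submodule.span_empty]⟩
  | insert v s _ ih =>
    obtain ⟨I, hI⟩ := ih
    obtain ⟨J, hJ⟩ := exists_halfspaceCone_sup_ray I v
    refine ⟨J, ?_⟩
    ext x
    rw [hJ, hI, Finset.coe_insert, PointedCone.hull, Submodule.mem_span_insert]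
    constructor
    · rintro ⟨t, ht, h⟩
      exact ⟨⟨t, ht⟩, _, h, (add_sub_cancel (t • v) x).symm⟩
    · rintro ⟨⟨t, ht⟩, z, hz, rfl⟩
      exact ⟨t, ht, by rwa [Nonneg.mk_smul, add_sub_cancel_left]⟩

theorem exists_mem_forall_pos {D : PointedCone 𝕜 E} (hnonneg : ∀ l ∈ I, ∀ x ∈ D, 0 ≤ l x)
    (hpos : ∀ l ∈ I, ∃ x ∈ D, l x ≠ 0) : ∃ x ∈ D, ∀ l ∈ I, 0 < l x := by
  choose! x hxD hx using hpos
  refine ⟨∑ l ∈ I, x l, sum_mem hxD, fun l hl => ?_⟩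
  rw [map_sum]
  exact Finset.sum_pos' (fun m hm => hnonneg l hl _ (hxD m hm))
    ⟨l, hl, (hnonneg l hl _ (hxD l hl)).lt_of_ne (hx l hl).symm⟩

theorem exists_neg_and_forall_eq_zero_iff {D : PointedCone 𝕜 E} (hD : D ≤ halfspaceCone V I)
    {y : E} (hy : y ∈ V) :
    (∃ m ∈ I, m y < 0 ∧ ∀ x ∈ D, m x = 0) ↔ ∀ x ∈ D, x + y ∉ halfspaceCone V I := by
  constructor
  · rintro ⟨m, hm, hmy, hmD⟩ x hx hxy
    have := hxy.2 m hm
    rw [map_add, hmD x hx, zero_add] at this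
    exact this.not_gt hmy
  · intro h
    by_contra! hcon
    obtain ⟨x, hxD, hx⟩ := exists_mem_forall_pos (D := D) (I := I.filter (· y < 0))
      (fun l hl x hx => (hD hx).2 l (Finset.mem_filter.1 hl).1)
      fun l hl => hcon l (Finset.mem_filter.1 hl).1 (Finset.mem_filter.1 hl).2
    have hfar : ∀ᶠ t : 𝕜 in atTop, ∀ m ∈ I, 0 ≤ t * m x + m y := by
      refine (Finset.eventually_all I).2 fun m hm => ?_
      by_cases hmy : m y < 0
      · have hmx := hx m (Finset.mem_filter.2 ⟨hm, hmy⟩)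
        exact (eventually_mul_add_pos hmx _).mono fun _ => le_of_lt
      · exact (eventually_ge_atTop 0).mono fun t ht =>
          add_nonneg (mul_nonneg ht ((hD hxD).2 m hm)) (not_lt.1 hmy)
    obtain ⟨t, ht, ht0⟩ := (hfar.and (eventually_ge_atTop 0)).exists
    refine h (t • x) (PointedCone.smul_mem D ht0 hxD)
      ⟨V.add_mem (V.smul_mem t (hD hxD).1) hy, fun m hm => ?_⟩
    rw [map_add, map_smul]
    exact ht m hm

/-- The face of `halfspaceCone V I` on which the functional `l` vanishes. -/
def wall (V : Submodule 𝕜 E) (I : Finset (Module.Dual 𝕜 E)) (l : Module.Dual 𝕜 E) :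
    PointedCone 𝕜 E := halfspaceCone (V ⊓ LinearMap.ker l) I

theorem mem_wall {l : Module.Dual 𝕜 E} {x : E} :
    x ∈ wall V I l ↔ x ∈ halfspaceCone V I ∧ l x = 0 := by
  rw [wall, mem_halfspaceCone, mem_halfspaceCone, Submodule.mem_inf, LinearMap.mem_ker,
    and_right_comm]

theorem wall_isFaceOf {l : Module.Dual 𝕜 E} (hl : l ∈ I) :
    (wall V I l).IsFaceOf (halfspaceCone V I) := by
  refine .of_mem_of_add_mem_left (fun x hx => (mem_wall.1 hx).1) fun {x y} hx hy hxy =>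
    mem_wall.2 ⟨hx, ?_⟩
  have hsum := (mem_wall.1 hxy).2
  rw [map_add] at hsum
  exact ((add_eq_zero_iff_of_nonneg (hx.2 l hl) (hy.2 l hl)).1 hsum).1

/-- The faces of `C` visible from `y`: those `F` such that no segment from a point of `F` to `y`
enters `C`. As `F` and `C` are cones, the sum `x + y` can stand for the points of the segment. -/
def visibleFaces (C : PointedCone 𝕜 E) (y : E) : Set (PointedCone 𝕜 E) :=
  {F | F.IsFaceOf C ∧ ∀ x ∈ F, x + y ∉ C}

theorem visibleFaces_neg {C : PointedCone 𝕜 E} {z : E} (hz : z ∈ C) :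
    visibleFaces C (-z) = {F | F.IsFaceOf C ∧ z ∉ F} := by
  refine Set.ext fun F => and_congr_right fun hF => ⟨fun h hzF => h z hzF ?_, fun hzF x hx h => ?_⟩
  · rw [add_neg_cancel]
    exact C.zero_mem
  · exact hzF (hF.mem_of_add_mem_left hz h (by rwa [add_neg_cancel_comm_assoc]))

theorem mem_visibleFaces_halfspaceCone {y : E} (hy : y ∈ V) {D : PointedCone 𝕜 E} :
    D ∈ visibleFaces (halfspaceCone V I) y ↔ ∃ m ∈ I, m y < 0 ∧ D.IsFaceOf (wall V I m) := by
  constructor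
  · rintro ⟨hD, h⟩
    obtain ⟨m, hm, hmy, hmD⟩ := (exists_neg_and_forall_eq_zero_iff hD.le hy).2 h
    exact ⟨m, hm, hmy, (hD.isFaceOf_iff_le (wall_isFaceOf hm)).2 fun x hx =>
      mem_wall.2 ⟨hD.le hx, hmD x hx⟩⟩
  · rintro ⟨m, hm, hmy, hD⟩
    have hDC := hD.trans (wall_isFaceOf hm)
    exact ⟨hDC, (exists_neg_and_forall_eq_zero_iff hDC.le hy).1
      ⟨m, hm, hmy, fun x hx => (mem_wall.1 (hD.le hx)).2⟩⟩

theorem mem_visibleFaces_wall {l : Module.Dual 𝕜 E} (hl : l ∈ I) {y : E}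
    (hy : y ∈ V ⊓ LinearMap.ker l) {D : PointedCone 𝕜 E} :
    D ∈ visibleFaces (wall V I l) y ↔
      ∃ m ∈ I, m y < 0 ∧ D.IsFaceOf (wall V I m) ∧ D.IsFaceOf (wall V I l) := by
  constructor
  · rintro ⟨hD, h⟩
    obtain ⟨m, hm, hmy, hDm⟩ := (mem_visibleFaces_halfspaceCone hy.1).1
      ⟨hD.trans (wall_isFaceOf hl), fun x hx hxy => h x hx (mem_wall.2 ⟨hxy, by
        rw [map_add, (mem_wall.1 (hD.le hx)).2, LinearMap.mem_ker.1 hy.2, add_zero]⟩)⟩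
    exact ⟨m, hm, hmy, hDm, hD⟩
  · rintro ⟨m, hm, hmy, hDm, hD⟩
    have hvis := (mem_visibleFaces_halfspaceCone hy.1).2 ⟨m, hm, hmy, hDm⟩
    exact ⟨hD, fun x hx hxy => hvis.2 x hx (mem_wall.1 hxy).1⟩

end HalfspaceCone

section FacetSystem

variable {𝕜 E : Type*} [Field 𝕜] [LinearOrder 𝕜] [IsStrictOrderedRing 𝕜]
  [AddCommGroup E] [Module 𝕜 E] {V : Submodule 𝕜 E} {I : Finset (Module.Dual 𝕜 E)}

/-- The walls of `halfspaceCone V I` are pairwise distinct and are its facets; moreover this cone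
has an interior point in `V`. Both are witnessed by points at which the functionals are positive. -/
structure IsFacetSystem (V : Submodule 𝕜 E) (I : Finset (Module.Dual 𝕜 E)) : Prop where
  exists_pos : ∃ p ∈ V, ∀ l ∈ I, 0 < l p
  exists_facet_pos : ∀ l ∈ I, ∃ w ∈ V, l w = 0 ∧ ∀ m ∈ I, m ≠ l → 0 < m w

theorem exists_irredundant_subset (V : Submodule 𝕜 E) (I : Finset (Module.Dual 𝕜 E)) :
    ∃ J ⊆ I, halfspaceCone V J = halfspaceCone V I ∧
      ∀ J' ⊂ J, ¬ halfspaceCone V J' ≤ halfspaceCone V J := by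
  obtain ⟨J, hJI, hJ, hmin⟩ := exists_minimal_le_of_wellFoundedLT
    (fun J => halfspaceCone V J = halfspaceCone V I) I rfl
  exact ⟨J, hJI, hJ, fun J' hJ' hle => hJ'.not_subset
    (hmin ((hle.antisymm (halfspaceCone_anti hJ'.subset)).trans hJ) hJ'.subset)⟩

theorem exists_isFacetSystem (h : ∃ p ∈ V, ∀ l ∈ I, 0 < l p) :
    ∃ J ⊆ I, halfspaceCone V J = halfspaceCone V I ∧ IsFacetSystem V J := by
  classical
  obtain ⟨p, hpV, hp⟩ := h
  obtain ⟨J, hJI, hJ, hmin⟩ := exists_irredundant_subset V I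
  refine ⟨J, hJI, hJ, ⟨p, hpV, fun l hl => hp l (hJI hl)⟩, fun l hl => ?_⟩
  obtain ⟨z, hz, hzJ⟩ := SetLike.not_le_iff_exists.1 (hmin _ (Finset.erase_ssubset hl))
  have hlz : l z < 0 := by
    by_contra! hlz
    refine hzJ ⟨hz.1, fun m hm => ?_⟩
    obtain rfl | hml := eq_or_ne m l
    · exact hlz
    · exact hz.2 m (Finset.mem_erase.2 ⟨hml, hm⟩)
  -- the segment from `p` to `z` leaves the cone through the wall of `l` alone
  refine ⟨l p • z - l z • p, V.sub_mem (V.smul_mem _ hz.1) (V.smul_mem _ hpV), ?_, ?_⟩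
  · simp only [map_sub, map_smul, smul_eq_mul, mul_comm, sub_self]
  · intro m hm hml
    have hmz := mul_nonneg (hp l (hJI hl)).le (hz.2 m (Finset.mem_erase.2 ⟨hml, hm⟩))
    have hmp := mul_neg_of_neg_of_pos hlz (hp m (hJI hm))
    simp only [map_sub, map_smul, smul_eq_mul]
    linarith

namespace IsFacetSystem

theorem eq_of_wall_le_wall (h : IsFacetSystem V I) {l m : Module.Dual 𝕜 E} (hl : l ∈ I)
    (hm : m ∈ I) (hlm : wall V I l ≤ wall V I m) : l = m := by
  obtain ⟨w, hwV, hlw, hw⟩ := h.exists_facet_pos l hl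
  by_contra hne
  have hw_wall : w ∈ wall V I l := by
    refine mem_wall.2 ⟨⟨hwV, fun k hk => ?_⟩, hlw⟩
    obtain rfl | hkl := eq_or_ne k l
    · exact hlw.ge
    · exact (hw k hk hkl).le
  exact (hw m hm (Ne.symm hne)).ne' (mem_wall.1 (hlm hw_wall)).2

theorem wall_ne (h : IsFacetSystem V I) {l : Module.Dual 𝕜 E} (hl : l ∈ I) :
    wall V I l ≠ halfspaceCone V I := by
  obtain ⟨p, hpV, hp⟩ := h.exists_pos
  intro heq
  have hp_wall : p ∈ wall V I l := heq ▸ ⟨hpV, fun m hm => (hp m hm).le⟩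
  exact (hp l hl).ne' (mem_wall.1 hp_wall).2

end IsFacetSystem

theorem exists_le_wall {D : PointedCone 𝕜 E} (hD : D.IsFaceOf (halfspaceCone V I))
    (hne : D ≠ halfspaceCone V I) : ∃ l ∈ I, D ≤ wall V I l := by
  obtain ⟨z, hz, hzD⟩ := SetLike.not_le_iff_exists.1 fun h => hne (le_antisymm hD.le h)
  have hvis : D ∈ visibleFaces (halfspaceCone V I) (-z) := by
    rw [visibleFaces_neg hz]
    exact ⟨hD, hzD⟩
  obtain ⟨l, hl, -, hDl⟩ := (mem_visibleFaces_halfspaceCone (V.neg_mem hz.1)).1 hvis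
  exact ⟨l, hl, hDl.le⟩

theorem IsFacetSystem.maximal_isFaceOf_iff (h : IsFacetSystem V I) {D : PointedCone 𝕜 E} :
    Maximal (fun D => D.IsFaceOf (halfspaceCone V I) ∧ D ≠ halfspaceCone V I) D ↔
      ∃ l ∈ I, wall V I l = D := by
  constructor
  · intro hD
    obtain ⟨l, hl, hDl⟩ := exists_le_wall hD.prop.1 hD.prop.2
    exact ⟨l, hl, (hD.eq_of_le ⟨wall_isFaceOf hl, h.wall_ne hl⟩ hDl).symm⟩
  · rintro ⟨l, hl, rfl⟩
    refine ⟨⟨wall_isFaceOf hl, h.wall_ne hl⟩, fun D hD hlD => ?_⟩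
    obtain ⟨m, hm, hDm⟩ := exists_le_wall hD.1 hD.2
    rwa [h.eq_of_wall_le_wall hl hm (hlD.trans hDm)]

theorem IsFacetSystem.exists_injOn_div (h : IsFacetSystem V I) {p : E} (hp : ∀ l ∈ I, 0 < l p) :
    ∃ z ∈ V, (I : Set (Module.Dual 𝕜 E)).InjOn fun l => l z / l p := by
  let f : {x : I × I // x.1 ≠ x.2} → Module.Dual 𝕜 E := fun x =>
    (x.1.1.1 p)⁻¹ • x.1.1.1 - (x.1.2.1 p)⁻¹ • x.1.2.1
  have hf : ∀ x z, f x z = x.1.1.1 z / x.1.1.1 p - x.1.2.1 z / x.1.2.1 p := fun x z => by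
    simp only [f, LinearMap.sub_apply, LinearMap.smul_apply, smul_eq_mul, inv_mul_eq_div]
  obtain ⟨z, hzV, hz⟩ := Module.Dual.exists_forall_mem_ne_zero_of_forall_exists V f fun x => by
    obtain ⟨w, hwV, hlw, hw⟩ := h.exists_facet_pos x.1.1 x.1.1.2
    have hmw := hw x.1.2 x.1.2.2 fun h => x.2 (Subtype.ext h.symm)
    refine ⟨w, hwV, ?_⟩
    rw [hf, hlw, zero_div, zero_sub]
    exact neg_ne_zero.2 (div_pos hmw (hp _ x.1.2.2)).ne'
  refine ⟨z, hzV, fun l hl m hm hlm => ?_⟩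
  by_contra hne
  exact hz ⟨⟨⟨l, hl⟩, ⟨m, hm⟩⟩, fun h => hne (Subtype.ext_iff.1 h)⟩
    ((hf _ z).trans (sub_eq_zero.2 hlm))

theorem IsFacetSystem.exists_generic (h : IsFacetSystem V I) {p y : E}
    (hp : ∀ l ∈ I, 0 < l p) (hy : y ∈ V) :
    ∃ q ∈ V, (I : Set (Module.Dual 𝕜 E)).InjOn (fun l => l q / l p) ∧
      ∀ l ∈ I, ∀ m ∈ I, l y < 0 → 0 ≤ m y → l q / l p < m q / m p := by
  obtain ⟨z, hzV, hz⟩ := h.exists_injOn_div hp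
  have hslope : ∀ l m : Module.Dual 𝕜 E, ∀ t : 𝕜,
      l (t • y + z) / l p - m (t • y + z) / m p =
        t * (l y / l p - m y / m p) + (l z / l p - m z / m p) := fun l m t => by
    simp only [map_add, map_smul, smul_eq_mul]
    ring
  have hinj : ∀ᶠ t : 𝕜 in atTop, ∀ l ∈ I, ∀ m ∈ I, l ≠ m →
      l (t • y + z) / l p - m (t • y + z) / m p ≠ 0 := by
    refine (Finset.eventually_all I).2 fun l hl => (Finset.eventually_all I).2 fun m hm => ?_
    simp only [hslope, eventually_imp_distrib_left]
    exact fun hlm => eventually_mul_add_ne_zero _ (sub_ne_zero.2 (hz.ne hl hm hlm))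
  have hlt : ∀ᶠ t : 𝕜 in atTop, ∀ l ∈ I, ∀ m ∈ I, l y < 0 → 0 ≤ m y →
      l (t • y + z) / l p - m (t • y + z) / m p < 0 := by
    refine (Finset.eventually_all I).2 fun l hl => (Finset.eventually_all I).2 fun m hm => ?_
    simp only [hslope, eventually_imp_distrib_left]
    exact fun hly hmy => eventually_mul_add_neg (sub_neg_of_lt ((div_neg_of_neg_of_pos hly
      (hp l hl)).trans_le (div_nonneg hmy (hp m hm).le))) _
  obtain ⟨t, ht_inj, ht_lt⟩ := (hinj.and hlt).exists
  refine ⟨t • y + z, V.add_mem (V.smul_mem t hy) hzV, fun l hl m hm hlm => ?_,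
    fun l hl m hm hly hmy => sub_neg.1 (ht_lt l hl m hm hly hmy)⟩
  by_contra hne
  exact ht_inj l hl m hm hne (sub_eq_zero.2 hlm)

theorem wall_eq_halfspaceCone_erase [DecidableEq (Module.Dual 𝕜 E)] (l : Module.Dual 𝕜 E) :
    wall V I l = halfspaceCone (V ⊓ LinearMap.ker l) (I.erase l) := by
  refine le_antisymm (halfspaceCone_anti (Finset.erase_subset _ _)) fun x hx =>
    ⟨hx.1, fun m hm => ?_⟩
  obtain rfl | hml := eq_or_ne m l
  · exact (LinearMap.mem_ker.1 hx.1.2).ge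
  · exact hx.2 m (Finset.mem_erase.2 ⟨hml, hm⟩)

theorem exists_halfspaceCone_eq_forall_pos (I : Finset (Module.Dual 𝕜 E)) :
    ∃ V J, halfspaceCone V J = halfspaceCone ⊤ I ∧ ∃ p ∈ V, ∀ l ∈ J, 0 < l p := by
  classical
  let C := halfspaceCone ⊤ I
  let V : Submodule 𝕜 E := Submodule.span 𝕜 C
  let J := I.filter fun l => ∃ x ∈ C, l x ≠ 0
  obtain ⟨p, hpC, hp⟩ := exists_mem_forall_pos (I := J) (D := C)
    (fun l hl x hx => hx.2 l (Finset.mem_filter.1 hl).1) fun l hl => (Finset.mem_filter.1 hl).2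
  refine ⟨V, J, le_antisymm (fun x hx => ⟨trivial, fun l hl => ?_⟩) fun x hx =>
    ⟨Submodule.subset_span hx, fun l hl => hx.2 l (Finset.mem_filter.1 hl).1⟩,
    p, Submodule.subset_span hpC, hp⟩
  by_cases hlJ : l ∈ J
  · exact hx.2 l hlJ
  · have hlC : ∀ w ∈ C, l w = 0 := fun w hw => by
      by_contra hne
      exact hlJ (Finset.mem_filter.2 ⟨hl, w, hw, hne⟩)
    have hV : V ≤ LinearMap.ker l := Submodule.span_le.2 hlC
    exact (LinearMap.mem_ker.1 (hV hx.1)).ge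

end FacetSystem

section LineShelling

theorem exists_equiv_strictMono {α β : Type*} [Fintype α] [LinearOrder β] {c : α → β}
    (hc : Function.Injective c) :
    ∃ e : Fin (Fintype.card α) ≃ α, StrictMono (c ∘ e) := by
  let e := (Fintype.equivFin α).symm
  refine ⟨(Tuple.sort (c ∘ e)).trans e, ?_⟩
  exact (Tuple.monotone_sort (c ∘ e)).strictMono_of_injective
    (hc.comp ((Tuple.sort (c ∘ e)).trans e).injective)

theorem exists_lt_iff_of_isLowerSet {n : ℕ} {s : Set (Fin n)} (hs : IsLowerSet s) :
    ∃ r ≤ n, ∀ i : Fin n, (i : ℕ) < r ↔ i ∈ s := by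
  obtain rfl | ⟨k, rfl⟩ := hs.eq_univ_or_Iio
  · exact ⟨n, le_rfl, fun i => iff_of_true i.2 trivial⟩
  · exact ⟨k, k.2.le, fun i => Iff.rfl⟩

variable {d : ℕ}

/-- `C` admits a shelling of its boundary with an initial segment consisting of the facets visible
from `y`. Quantifying over `y` is what makes the induction on walls work. -/
def HasShellingFrom (C : RCone d) (y : Fin d → ℝ) : Prop :=
  ∃ (t : ℕ) (D : Fin t → RCone d), IsShelling C.boundaryFan D ∧
    ∃ r ≤ t, (⋃ l : Fin t, ⋃ _ : (l : ℕ) < r, (D l).fan) = visibleFaces C y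

namespace IsFacetSystem

variable {V : Submodule ℝ (Fin d → ℝ)} {I : Finset (Module.Dual ℝ (Fin d → ℝ))} {n : ℕ}

theorem isFacetOrdering (h : IsFacetSystem V I) (e : Fin n ≃ I) :
    IsFacetOrdering (RCone.boundaryFan (halfspaceCone V I)) fun k => wall V I (e k).1 := by
  refine ⟨fun i j hij => e.injective (Subtype.ext ?_), fun D => ?_⟩
  · exact h.eq_of_wall_le_wall (e i).2 (e j).2 (le_of_eq hij)
  · rw [show Maximal (· ∈ RCone.boundaryFan (halfspaceCone V I)) D ↔ _ from h.maximal_isFaceOf_iff]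
    exact (e.exists_congr_left (p := fun k => wall V I (e k).1 = D)).trans (by simp)

theorem iUnion_fan_inter_fan_wall_eq (e : Fin n ≃ I) {z : Fin d → ℝ} (j : Fin n)
    (hz : z ∈ V ⊓ LinearMap.ker (e j).1) (hneg : ∀ i, (e i).1 z < 0 ↔ i < j) :
    (⋃ i : Fin n, ⋃ _ : i < j, RCone.fan (wall V I (e i).1) ∩ RCone.fan (wall V I (e j).1)) =
      visibleFaces (wall V I (e j).1) z := by
  ext D
  simp only [Set.mem_iUnion, mem_visibleFaces_wall (e j).2 hz, exists_prop]
  constructor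
  · rintro ⟨i, hij, hDi, hDj⟩
    exact ⟨e i, (e i).2, (hneg i).2 hij, hDi, hDj⟩
  · rintro ⟨m, hm, hmz, hDm, hDj⟩
    obtain ⟨i, hi⟩ := e.surjective ⟨m, hm⟩
    obtain rfl : (e i).1 = m := congrArg Subtype.val hi
    exact ⟨i, (hneg i).1 hmz, hDm, hDj⟩

theorem isShelling_of_forall_neg_iff (h : IsFacetSystem V I) (e : Fin n ≃ I)
    (z : Fin n → Fin d → ℝ) (hz : ∀ j, z j ∈ V ⊓ LinearMap.ker (e j).1)
    (hneg : ∀ i j, (e i).1 (z j) < 0 ↔ i < j)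
    (hshell : ∀ j, HasShellingFrom (wall V I (e j).1) (z j)) :
    IsShelling (RCone.boundaryFan (halfspaceCone V I)) fun k => wall V I (e k).1 := by
  choose t D hD r hrt hr using hshell
  refine .step (h.isFacetOrdering e) t D hD fun j hj => ?_
  have heq := iUnion_fan_inter_fan_wall_eq e j (hz j) (hneg · j)
  have hnonempty : (⋃ i : Fin n, ⋃ _ : i < j,
      RCone.fan (wall V I (e i).1) ∩ RCone.fan (wall V I (e j).1)).Nonempty := by
    have h0 := wall_isFaceOf (V := V) (e ⟨0, hj.trans j.2⟩).2
    have hj' := wall_isFaceOf (V := V) (e j).2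
    exact ⟨_, Set.mem_iUnion₂.2 ⟨⟨0, hj.trans j.2⟩, hj,
      ((h0.inf_left hj').isFaceOf_iff_le h0).2 inf_le_left,
      ((h0.inf_left hj').isFaceOf_iff_le hj').2 inf_le_right⟩⟩
  refine ⟨hnonempty, r j, Nat.one_le_iff_ne_zero.2 fun hr0 => ?_, hrt j, heq.trans (hr j).symm⟩
  obtain ⟨D', hD'⟩ := hnonempty
  rw [heq, ← hr j, hr0] at hD'
  simp at hD'

theorem iUnion_fan_wall_eq (e : Fin n ≃ I) {y : Fin d → ℝ} (hy : y ∈ V) {r : ℕ}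
    (hr : ∀ i : Fin n, (i : ℕ) < r ↔ (e i).1 y < 0) :
    (⋃ i : Fin n, ⋃ _ : (i : ℕ) < r, RCone.fan (wall V I (e i).1)) =
      visibleFaces (halfspaceCone V I) y := by
  ext D
  simp only [Set.mem_iUnion, mem_visibleFaces_halfspaceCone hy, exists_prop, hr]
  constructor
  · rintro ⟨i, hi, hD⟩
    exact ⟨e i, (e i).2, hi, hD⟩
  · rintro ⟨m, hm, hmy, hD⟩
    obtain ⟨i, hi⟩ := e.surjective ⟨m, hm⟩
    obtain rfl : (e i).1 = m := congrArg Subtype.val hi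
    exact ⟨i, hmy, hD⟩

theorem hasShellingFrom (h : IsFacetSystem V I)
    (ih : ∀ l ∈ I, ∀ z ∈ V ⊓ LinearMap.ker l, HasShellingFrom (wall V I l) z)
    {y : Fin d → ℝ} (hy : y ∈ V) : HasShellingFrom (halfspaceCone V I) y := by
  obtain ⟨p, hpV, hp⟩ := h.exists_pos
  obtain ⟨q, hqV, hinj, hlt⟩ := h.exists_generic hp hy
  let c : I → ℝ := fun l => l.1 q / l.1 p
  obtain ⟨e, he⟩ := exists_equiv_strictMono (c := c) (Set.injOn_iff_injective.1 hinj)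
  -- the line through `q` with direction `p` meets the hyperplane of `e j` in `z j`
  let z : Fin (Fintype.card I) → Fin d → ℝ := fun j => q - c (e j) • p
  have hz_apply : ∀ i j, (e i).1 (z j) = (e i).1 p * (c (e i) - c (e j)) := fun i j => by
    have := (hp _ (e i).2).ne'
    simp only [z, c, map_sub, map_smul, smul_eq_mul]
    field_simp
  have hz : ∀ j, z j ∈ V ⊓ LinearMap.ker (e j).1 := fun j =>
    ⟨V.sub_mem hqV (V.smul_mem _ hpV), LinearMap.mem_ker.2 (by rw [hz_apply, sub_self, mul_zero])⟩
  have hneg : ∀ i j, (e i).1 (z j) < 0 ↔ i < j := fun i j => by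
    rw [hz_apply, ← smul_eq_mul, smul_neg_iff_of_pos_left (hp _ (e i).2), sub_neg]
    exact he.lt_iff_lt
  have hlower : IsLowerSet {i | (e i).1 y < 0} := fun i j hji hi => by
    by_contra hj
    exact (hlt _ (e i).2 _ (e j).2 hi (not_lt.1 hj)).not_ge (he.monotone hji)
  obtain ⟨r, hrn, hr⟩ := exists_lt_iff_of_isLowerSet hlower
  exact ⟨_, _, h.isShelling_of_forall_neg_iff e z hz hneg fun j => ih _ (e j).2 _ (hz j),
    r, hrn, iUnion_fan_wall_eq e hy hr⟩

end IsFacetSystem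

theorem hasShellingFrom_halfspaceCone (V : Submodule ℝ (Fin d → ℝ))
    (I : Finset (Module.Dual ℝ (Fin d → ℝ))) (h : ∃ p ∈ V, ∀ l ∈ I, 0 < l p) {y : Fin d → ℝ}
    (hy : y ∈ V) : HasShellingFrom (halfspaceCone V I) y := by
  classical
  induction hn : I.card using Nat.strong_induction_on generalizing V I y with
  | _ n ih =>
    obtain ⟨J, hJI, hJ, hfacet⟩ := exists_isFacetSystem h
    rw [← hJ]
    refine hfacet.hasShellingFrom (fun l hl z hz => ?_) hy
    obtain ⟨w, hwV, hlw, hw⟩ := hfacet.exists_facet_pos l hl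
    rw [wall_eq_halfspaceCone_erase]
    refine ih _ (hn ▸ (Finset.card_lt_card (Finset.erase_ssubset hl)).trans_le
      (Finset.card_le_card hJI)) _ _ ⟨w, Submodule.mem_inf.2 ⟨hwV, hlw⟩, fun m hm => ?_⟩ hz rfl
    exact hw m (Finset.mem_of_mem_erase hm) (Finset.ne_of_mem_erase hm)

theorem exists_isShelling_boundaryFan {C : RCone d} (hC : Submodule.FG C) {z : Fin d → ℝ}
    (hz : z ∈ C) : ∃ (t : ℕ) (D : Fin t → RCone d), IsShelling C.boundaryFan D ∧
      ∃ r ≤ t, (⋃ l : Fin t, ⋃ _ : (l : ℕ) < r, (D l).fan) = {F | F.IsFaceOf C ∧ z ∉ F} := by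
  obtain ⟨s, rfl⟩ := hC
  obtain ⟨I, hI⟩ := exists_halfspaceCone_eq_hull (𝕜 := ℝ) s
  obtain ⟨V, J, hJ, hpos⟩ := exists_halfspaceCone_eq_forall_pos I
  have heq := hJ.trans hI
  rw [← visibleFaces_neg hz]
  change HasShellingFrom (PointedCone.hull ℝ (s : Set (Fin d → ℝ))) (-z)
  rw [← heq]
  exact hasShellingFrom_halfspaceCone V J hpos
    (V.neg_mem (show z ∈ halfspaceCone V J from heq ▸ hz).1)

end LineShelling

section RelativeInterior

theorem mem_intrinsicInterior_iff_mem_nhdsWithin {𝕜 V P : Type*} [Ring 𝕜] [AddCommGroup V]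
    [Module 𝕜 V] [TopologicalSpace P] [AddTorsor V P] {s : Set P} {x : P} :
    x ∈ intrinsicInterior 𝕜 s ↔ x ∈ s ∧ s ∈ 𝓝[(affineSpan 𝕜 s : Set P)] x := by
  constructor
  · rintro ⟨x, hx, rfl⟩
    exact ⟨interior_subset (s := Subtype.val ⁻¹' s) hx,
      preimage_coe_mem_nhds_subtype.1 (mem_interior_iff_mem_nhds.1 hx)⟩
  · rintro ⟨hxs, hx⟩
    exact ⟨⟨x, subset_affineSpan 𝕜 s hxs⟩,
      mem_interior_iff_mem_nhds.2 (preimage_coe_mem_nhds_subtype.2 hx), rfl⟩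

theorem coe_affineSpan_eq_span {𝕜 E : Type*} [Ring 𝕜] [AddCommGroup E] [Module 𝕜 E]
    {s : Set E} (h : 0 ∈ s) : (affineSpan 𝕜 s : Set E) = Submodule.span 𝕜 s := by
  rw [← affineSpan_insert_zero, Set.insert_eq_of_mem h]

variable {E : Type*} [NormedAddCommGroup E] [NormedSpace ℝ E] {C D F : PointedCone ℝ E} {x : E}

theorem eq_of_isFaceOf_of_mem_intrinsicInterior (hF : F.IsFaceOf D) (hxF : x ∈ F)
    (hx : x ∈ intrinsicInterior ℝ (D : Set E)) : F = D := by
  refine hF.le.antisymm fun z hz => ?_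
  obtain ⟨hxD, hnhds⟩ := mem_intrinsicInterior_iff_mem_nhdsWithin.1 hx
  -- the line from `z` to `x` can be prolonged beyond `x` inside `D`
  have hline : Tendsto (AffineMap.lineMap x z : ℝ → E) (𝓝 0)
      (𝓝[(affineSpan ℝ (D : Set E) : Set E)] x) := by
    refine tendsto_nhdsWithin_iff.2 ⟨?_, .of_forall fun t => AffineMap.lineMap_mem t
      (subset_affineSpan ℝ _ hxD) (subset_affineSpan ℝ _ hz)⟩
    exact (by fun_prop : Continuous (AffineMap.lineMap x z : ℝ → E)).tendsto' 0 x
      (AffineMap.lineMap_apply_zero x z)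
  obtain ⟨t, htD, ht : t < 0⟩ := (((hline.eventually_mem hnhds).filter_mono
    nhdsWithin_le_nhds).and (self_mem_nhdsWithin : Set.Iio (0 : ℝ) ∈ 𝓝[<] 0)).exists
  refine hF.mem_of_smul_add_mem (a := -t) hz htD (neg_pos.2 ht) ?_
  rw [show -t • z + AffineMap.lineMap x z t = (1 - t) • x by
    rw [AffineMap.lineMap_apply_module]; module]
  exact PointedCone.smul_mem F (by linarith) hxF

theorem exists_smul_sub_mem (hx : x ∈ D) (h : ∀ F : PointedCone ℝ E, F.IsFaceOf D → x ∈ F → F = D)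
    {w : E} (hw : w ∈ D) : ∃ c : ℝ, 0 < c ∧ c • x - w ∈ D := by
  let F : PointedCone ℝ E :=
    { carrier := {z | z ∈ D ∧ ∃ c : ℝ, 0 ≤ c ∧ c • x - z ∈ D}
      zero_mem' := ⟨D.zero_mem, 0, le_rfl, by simp⟩
      add_mem' := by
        rintro z w ⟨hz, a, ha, haz⟩ ⟨hw, b, hb, hbw⟩
        refine ⟨D.add_mem hz hw, a + b, add_nonneg ha hb, ?_⟩
        convert D.add_mem haz hbw using 1
        module
      smul_mem' := by
        rintro ⟨a, ha⟩ z ⟨hz, b, hb, hbz⟩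
        refine ⟨PointedCone.smul_mem D ha hz, a * b, mul_nonneg ha hb, ?_⟩
        convert PointedCone.smul_mem D ha hbz using 1
        rw [Nonneg.mk_smul, smul_sub, mul_smul] }
  have hF : F.IsFaceOf D := by
    refine .of_mem_of_add_mem_left (fun z hz => hz.1) fun {z w} hz hw ⟨_, c, hc, hzw⟩ =>
      ⟨hz, c, hc, ?_⟩
    convert D.add_mem hzw hw using 1
    abel
  have hxF : x ∈ F := ⟨hx, 1, zero_le_one, by simp⟩
  obtain ⟨-, c, hc, hcw⟩ : w ∈ F := h F hF hxF ▸ hw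
  refine ⟨c + 1, by positivity, ?_⟩
  convert D.add_mem hcw hx using 1
  module

theorem mem_intrinsicInterior_iff_forall_isFaceOf [FiniteDimensional ℝ E] :
    x ∈ intrinsicInterior ℝ (D : Set E) ↔
      x ∈ D ∧ ∀ F : PointedCone ℝ E, F.IsFaceOf D → x ∈ F → F = D := by
  refine ⟨fun hx => ⟨intrinsicInterior_subset hx, fun F hF hxF =>
    eq_of_isFaceOf_of_mem_intrinsicInterior hF hxF hx⟩, fun ⟨hxD, h⟩ => ?_⟩
  obtain ⟨w, hw⟩ := Set.Nonempty.intrinsicInterior D.convex ⟨0, D.zero_mem⟩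
  obtain ⟨c, hc, hcw⟩ := exists_smul_sub_mem hxD h (intrinsicInterior_subset hw)
  rw [mem_intrinsicInterior_iff_mem_nhdsWithin, coe_affineSpan_eq_span D.zero_mem] at hw ⊢
  have hcont : Tendsto (fun v => c • v - (c • x - w)) (𝓝[(Submodule.span ℝ (D : Set E) : Set E)] x)
      (𝓝[(Submodule.span ℝ (D : Set E) : Set E)] w) := by
    refine tendsto_nhdsWithin_iff.2 ⟨?_, ?_⟩
    · exact ((by fun_prop : Continuous fun v => c • v - (c • x - w)).tendsto' x w
        (sub_sub_cancel _ _)).mono_left nhdsWithin_le_nhds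
    · filter_upwards [self_mem_nhdsWithin] with v hv
      exact Submodule.sub_mem _ (Submodule.smul_mem _ c hv) (Submodule.subset_span hcw)
  refine ⟨hxD, ?_⟩
  filter_upwards [hcont.eventually_mem hw.2] with v hv
  have hmem := PointedCone.smul_mem D (inv_nonneg.2 hc.le) (D.add_mem hv hcw)
  rwa [sub_add_cancel, inv_smul_smul₀ hc.ne'] at hmem

theorem exists_isFaceOf_mem_intrinsicInterior [FiniteDimensional ℝ E] (hx : x ∈ C) :
    ∃ D : PointedCone ℝ E, D.IsFaceOf C ∧ x ∈ intrinsicInterior ℝ (D : Set E) := by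
  have hD := PointedCone.IsFaceOf.sInf {F | F.IsFaceOf C ∧ x ∈ F} fun F hF => hF.1
  refine ⟨_, hD, mem_intrinsicInterior_iff_forall_isFaceOf.2
    ⟨⟨hx, Submodule.mem_sInf.2 fun F hF => hF.2⟩, fun F hF hxF => hF.le.antisymm ?_⟩⟩
  exact inf_le_right.trans (sInf_le ⟨hF.trans hD, hxF⟩)

end RelativeInterior

namespace RCone

variable {d : ℕ} {C D : RCone d}

theorem IsRational.fg (hC : C.IsRational) : Submodule.FG C := by
  obtain ⟨s, rfl⟩ := hC
  exact Submodule.fg_span (s.finite_toSet.image _)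

theorem zero_mem_latticePoints (C : RCone d) : (0 : Fin d → ℤ) ∈ C.latticePoints := by
  rw [latticePoints, Set.mem_ofPred_eq, RationalPointedFan.latticeVec_zero]
  exact C.zero_mem

theorem add_mem_latticePoints {a b : Fin d → ℤ} (ha : a ∈ C.latticePoints)
    (hb : b ∈ C.latticePoints) : a + b ∈ C.latticePoints := by
  rw [latticePoints, Set.mem_ofPred_eq, RationalPointedFan.latticeVec_add]
  exact C.add_mem ha hb

theorem mem_latticePoints_of_add_mem (hF : PointedCone.IsFaceOf D C) {a b : Fin d → ℤ}
    (ha : a ∈ C.latticePoints) (hb : b ∈ C.latticePoints) (hab : a + b ∈ D.latticePoints) :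
    a ∈ D.latticePoints ∧ b ∈ D.latticePoints := by
  rw [latticePoints, Set.mem_ofPred_eq, RationalPointedFan.latticeVec_add] at hab
  exact (hF.add_mem_iff_mem ha hb).1 hab

theorem relintLatticePoints_subset : C.relintLatticePoints ⊆ C.latticePoints :=
  fun _ ha => intrinsicInterior_subset (𝕜 := ℝ) (s := (C : Set (Fin d → ℝ))) ha

theorem IsRational.relintLatticePoints_nonempty (hC : C.IsRational) :
    C.relintLatticePoints.Nonempty := by
  obtain ⟨s, hs⟩ := hC
  have hsC : ∀ a ∈ s, latticeVec a ∈ C := fun a ha =>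
    hs ▸ Submodule.subset_span (Set.mem_image_of_mem _ ha)
  have hsum : latticeVec (∑ a ∈ s, a) = ∑ a : s, latticeVec a.1 := by
    rw [Finset.sum_coe_sort s latticeVec]
    exact map_sum (AddMonoidHom.mk' latticeVec RationalPointedFan.latticeVec_add) _ s
  refine ⟨∑ a ∈ s, a, mem_intrinsicInterior_iff_forall_isFaceOf.2
    ⟨hsum ▸ sum_mem fun a _ => hsC a a.2, fun F hF hmem => hF.le.antisymm ?_⟩⟩
  rw [hsum] at hmem
  rw [hs]
  refine Submodule.span_le.2 ?_
  rintro _ ⟨a, ha, rfl⟩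
  exact hF.mem_of_sum_mem (fun a : s => hsC a a.2) hmem ⟨a, ha⟩

end RCone

/-! ### Shellings of fans -/

theorem IsShelling.isFacetOrdering {d : ℕ} {S : Set (RCone d)} {s : ℕ} {C : Fin s → RCone d}
    (h : IsShelling S C) : IsFacetOrdering S C := by
  cases h with
  | dim_zero facets _ => exact facets
  | step facets _ _ _ _ => exact facets

/-- The lattice points of `C j` that lie in none of the cones `C i` with `i < j`. They index the
monomials by which the step of the filtration of `K[Σ]` belonging to `C j` grows. -/
def newPoints {d s : ℕ} (C : Fin s → RCone d) (j : Fin s) : Set (Fin d → ℤ) :=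
  {a | a ∈ (C j).latticePoints ∧ ∀ i < j, a ∉ (C i).latticePoints}

theorem mem_of_newPoints_eq {d s : ℕ} {C : Fin s → RCone d} {j : Fin s} {γ : Fin d → ℤ}
    (h : newPoints C j = (γ + ·) '' (C j).latticePoints) : γ ∈ newPoints C j :=
  h ▸ ⟨0, (C j).zero_mem_latticePoints, add_zero γ⟩

namespace RationalPointedFan

variable {d : ℕ} {S : RationalPointedFan d} {C D : RCone d}

theorem isFaceOf_of_mem_relint {a : Fin d → ℤ} (hC : C ∈ S.cones) (hD : D ∈ S.cones)
    (haD : a ∈ D.relintLatticePoints) (haC : a ∈ C.latticePoints) : PointedCone.IsFaceOf D C := by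
  obtain ⟨hface, hface'⟩ := S.inter_face C hC D hD
  rwa [eq_of_isFaceOf_of_mem_intrinsicInterior hface'
    ⟨haC, RCone.relintLatticePoints_subset haD⟩ haD] at hface

theorem isFaceOf_of_latticePoints_subset (hC : C ∈ S.cones) (hD : D ∈ S.cones)
    (h : D.latticePoints ⊆ C.latticePoints) : PointedCone.IsFaceOf D C := by
  obtain ⟨a, ha⟩ := (S.rational D hD).relintLatticePoints_nonempty
  exact isFaceOf_of_mem_relint hC hD ha (h (RCone.relintLatticePoints_subset ha))

theorem add_mem_latticePoints_iff (hC : C ∈ S.cones) {a b : Fin d → ℤ}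
    (h : S.InCommonCone a b) :
    a + b ∈ C.latticePoints ↔ a ∈ C.latticePoints ∧ b ∈ C.latticePoints := by
  refine ⟨fun hab => ?_, fun ⟨ha, hb⟩ => RCone.add_mem_latticePoints ha hb⟩
  obtain ⟨D, hD, ha, hb⟩ := h
  exact (RCone.mem_latticePoints_of_add_mem (S.inter_face D hD C hC).1 ha hb
    ⟨RCone.add_mem_latticePoints ha hb, hab⟩).imp And.right And.right

variable {s : ℕ} {F : Fin s → RCone d} {j : Fin s} {γ : Fin d → ℤ}

theorem add_mem_newPoints (hF : ∀ i, F i ∈ S.cones) {a b : Fin d → ℤ}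
    (ha : a ∈ newPoints F j) (hb : b ∈ (F j).latticePoints) : a + b ∈ newPoints F j :=
  ⟨RCone.add_mem_latticePoints ha.1 hb, fun i hi hab =>
    ha.2 i hi ((S.add_mem_latticePoints_iff (hF i) ⟨F j, hF j, ha.1, hb⟩).1 hab).1⟩

theorem newPoints_nonempty (hF : IsFacetOrdering S.cones F) (j : Fin s) :
    (newPoints F j).Nonempty := by
  have hmax i : Maximal (· ∈ S.cones) (F i) := (hF.2 _).1 ⟨i, rfl⟩
  obtain ⟨a, ha⟩ := (S.rational _ (hmax j).prop).relintLatticePoints_nonempty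
  refine ⟨a, RCone.relintLatticePoints_subset ha, fun i hi hai => hi.ne' (hF.1 ?_)⟩
  exact (hmax j).eq_of_le (hmax i).prop
    (isFaceOf_of_mem_relint (hmax i).prop (hmax j).prop ha hai).le

theorem mem_newPoints_iff_of_mem_relint (hF : ∀ i, F i ∈ S.cones) (hD : D ∈ (F j).fan)
    {a : Fin d → ℤ} (ha : a ∈ D.relintLatticePoints) :
    a ∈ newPoints F j ↔ D ∉ ⋃ i : Fin s, ⋃ _ : i < j, (F i).fan := by
  have hDS : D ∈ S.cones := (S.face_iff _ (hF j) D (PointedCone.IsFaceOf.le hD)).1 hD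
  have hsub : ∀ i, D ∈ (F i).fan → a ∈ (F i).latticePoints := fun i hDi =>
    PointedCone.IsFaceOf.le hDi (RCone.relintLatticePoints_subset ha)
  simp only [Set.mem_iUnion, exists_prop, not_exists, not_and]
  exact ⟨fun h i hi hDi => h.2 i hi (hsub i hDi), fun h =>
    ⟨hsub j hD, fun i hi hai => h i hi (isFaceOf_of_mem_relint (hF i) hDS ha hai)⟩⟩

theorem iUnion_relintLatticePoints_eq_newPoints (hF : ∀ i, F i ∈ S.cones)
    (hstar : latticeStar (F j).fan γ = (F j).fan \ ⋃ i : Fin s, ⋃ _ : i < j, (F i).fan) :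
    (⋃ D ∈ latticeStar (F j).fan γ, D.relintLatticePoints) = newPoints F j := by
  rw [hstar]
  ext a
  simp only [Set.mem_iUnion₂]
  constructor
  · rintro ⟨D, ⟨hD, hnew⟩, ha⟩
    exact (mem_newPoints_iff_of_mem_relint hF hD ha).2 hnew
  · intro ha
    obtain ⟨D, hD, haD⟩ := exists_isFaceOf_mem_intrinsicInterior (C := F j) ha.1
    exact ⟨D, ⟨hD, (mem_newPoints_iff_of_mem_relint hF hD haD).1 ha⟩, haD⟩

theorem latticeStar_eq_of_newPoints_eq (hF : ∀ i, F i ∈ S.cones)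
    (h : newPoints F j = (γ + ·) '' (F j).latticePoints) :
    latticeStar (F j).fan γ = (F j).fan \ ⋃ i : Fin s, ⋃ _ : i < j, (F i).fan := by
  have hγ := mem_of_newPoints_eq h
  refine Set.ext fun D => and_congr_right fun hD => ⟨fun hγD hDnew => ?_, fun hDnew => ?_⟩
  · obtain ⟨i, hi, hDi⟩ := Set.mem_iUnion₂.1 hDnew
    exact hγ.2 i hi (PointedCone.IsFaceOf.le hDi hγD)
  · have hDS : D ∈ S.cones := (S.face_iff _ (hF j) D (PointedCone.IsFaceOf.le hD)).1 hD
    obtain ⟨a, ha⟩ := (S.rational D hDS).relintLatticePoints_nonempty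
    obtain ⟨b, hb, rfl⟩ := h ▸ (mem_newPoints_iff_of_mem_relint hF hD ha).2 hDnew
    exact (RCone.mem_latticePoints_of_add_mem hD hγ.1 hb (RCone.relintLatticePoints_subset ha)).1

theorem newPoints_eq_iff (hF : ∀ i, F i ∈ S.cones) :
    newPoints F j = (γ + ·) '' (F j).latticePoints ↔
      latticeStar (F j).fan γ = (F j).fan \ (⋃ i : Fin s, ⋃ _ : i < j, (F i).fan) ∧
      (⋃ D ∈ latticeStar (F j).fan γ, D.relintLatticePoints) =
        (γ + ·) '' (F j).latticePoints := by
  constructor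
  · intro h
    have hstar := latticeStar_eq_of_newPoints_eq hF h
    exact ⟨hstar, (iUnion_relintLatticePoints_eq_newPoints hF hstar).trans h⟩
  · rintro ⟨hstar, h⟩
    rw [← iUnion_relintLatticePoints_eq_newPoints hF hstar, h]

theorem iUnion_fan_inter_fan_eq (hF : ∀ i, F i ∈ S.cones)
    (h : newPoints F j = (γ + ·) '' (F j).latticePoints) :
    (⋃ i : Fin s, ⋃ _ : i < j, (F i).fan ∩ (F j).fan) =
      {D | D.IsFaceOf (F j) ∧ latticeVec γ ∉ D} := by
  simp only [← Set.iUnion_inter]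
  ext D
  have hstar := Set.ext_iff.1 (latticeStar_eq_of_newPoints_eq hF h) D
  simp only [latticeStar, Set.mem_ofPred_eq, Set.mem_sdiff, and_congr_right_iff] at hstar
  exact and_comm.trans (and_congr_right fun hD => by rw [hstar hD, not_not])

theorem isShelling_of_newPoints_eq (hF : IsFacetOrdering S.cones F)
    (h : ∀ j, ∃ γ, newPoints F j = (γ + ·) '' (F j).latticePoints) : IsShelling S.cones F := by
  have hFS : ∀ i, F i ∈ S.cones := fun i => ((hF.2 _).1 ⟨i, rfl⟩).prop
  choose γ hnew using h
  choose t D hD r hrt hr using fun j =>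
    exists_isShelling_boundaryFan (S.rational _ (hFS j)).fg (mem_of_newPoints_eq (hnew j)).1
  refine .step hF t D hD fun j hj => ?_
  have hnonempty : (⋃ i : Fin s, ⋃ _ : i < j, (F i).fan ∩ (F j).fan).Nonempty :=
    ⟨_, Set.mem_iUnion₂.2 ⟨⟨0, hj.trans j.2⟩, hj, S.inter_face _ (hFS _) _ (hFS j)⟩⟩
  have heq := (iUnion_fan_inter_fan_eq hFS (hnew j)).trans (hr j).symm
  refine ⟨hnonempty, r j, Nat.one_le_iff_ne_zero.2 fun hr0 => ?_, hrt j, heq⟩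
  simp [heq, hr0] at hnonempty

theorem exists_newPoints_eq_iff_exists_isShelling :
    (∃ (s : ℕ) (C : Fin s → RCone d), IsFacetOrdering S.cones C ∧
      ∀ j, ∃ γ, newPoints C j = (γ + ·) '' (C j).latticePoints) ↔
    ∃ (s : ℕ) (C : Fin s → RCone d), IsShelling S.cones C ∧
      ∀ j : Fin s, 0 < (j : ℕ) → ∃ γ ∈ (C j).latticePoints,
        latticeStar (C j).fan γ = ((C j).fan \ (⋃ i : Fin s, ⋃ _ : i < j, (C i).fan)) ∧
        (⋃ D ∈ latticeStar (C j).fan γ, D.relintLatticePoints) =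
          (γ + ·) '' (C j).latticePoints := by
  refine exists_congr fun s => exists_congr fun C => ⟨fun ⟨hC, h⟩ => ?_, fun ⟨hC, h⟩ => ?_⟩
  · refine ⟨isShelling_of_newPoints_eq hC h, fun j _ => ?_⟩
    obtain ⟨γ, hγ⟩ := h j
    exact ⟨γ, (mem_of_newPoints_eq hγ).1,
      (newPoints_eq_iff fun i => ((hC.2 _).1 ⟨i, rfl⟩).prop).1 hγ⟩
  · refine ⟨hC.isFacetOrdering, fun j => ?_⟩
    obtain hj | hj := (j : ℕ).eq_zero_or_pos
    · refine ⟨0, ?_⟩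
      simp [newPoints, Fin.lt_def, hj]
    · obtain ⟨γ, -, hγ⟩ := h j hj
      exact ⟨γ, (newPoints_eq_iff fun i => ((hC.isFacetOrdering.2 _).1 ⟨i, rfl⟩).prop).2 hγ⟩

end RationalPointedFan

/-! ### Clean filtrations of reduced rings -/

section CleanFiltration

variable {R : Type*} [CommRing R]

section CyclicQuotient

variable {M : Type*} [AddCommGroup M] [Module R M] {N N' : Submodule R M} {P : Ideal R}

theorem exists_eq_sup_span_of_quotient_equiv (hle : N ≤ N')
    (e : (N' ⧸ N.submoduleOf N') ≃ₗ[R] (R ⧸ P)) :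
    ∃ y, N' = N ⊔ R ∙ y ∧ ∀ g : R, g • y ∈ N ↔ g ∈ P := by
  obtain ⟨⟨y, hy⟩, hye⟩ := Submodule.Quotient.mk_surjective _ (e.symm (Ideal.Quotient.mk P 1))
  have symm_mk (g : R) : e.symm (Ideal.Quotient.mk P g) =
      Submodule.Quotient.mk (g • (⟨y, hy⟩ : N')) := by
    rw [Submodule.Quotient.mk_smul, hye, ← map_smul, Algebra.smul_def, map_one, mul_one,
      Ideal.Quotient.algebraMap_eq]
  refine ⟨y, le_antisymm (fun x hx => ?_)
    (sup_le hle ((Submodule.span_singleton_le_iff_mem _ _).2 hy)), fun g => ?_⟩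
  · obtain ⟨g, hg⟩ := Ideal.Quotient.mk_surjective (e (Submodule.Quotient.mk ⟨x, hx⟩))
    have hxg := symm_mk g
    rw [hg, LinearEquiv.symm_apply_apply, Submodule.Quotient.eq] at hxg
    exact Submodule.mem_sup.2 ⟨x - g • y, hxg, g • y,
      Submodule.smul_mem _ g (Submodule.mem_span_singleton_self y), sub_add_cancel _ _⟩
  · rw [← Ideal.Quotient.eq_zero_iff_mem (I := P), ← e.symm.map_eq_zero_iff, symm_mk,
      Submodule.Quotient.mk_eq_zero]
    rfl

theorem nonempty_quotient_sup_span_equiv {y : M} (hann : ∀ g : R, g • y ∈ N ↔ g ∈ P) :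
    Nonempty (((N ⊔ R ∙ y : Submodule R M) ⧸ N.submoduleOf (N ⊔ R ∙ y)) ≃ₗ[R] (R ⧸ P)) := by
  have hy : y ∈ N ⊔ R ∙ y := Submodule.mem_sup_right (Submodule.mem_span_singleton_self y)
  let f := (N.submoduleOf (N ⊔ R ∙ y)).mkQ ∘ₗ LinearMap.toSpanSingleton R _ ⟨y, hy⟩
  have hf : Function.Surjective f := fun x => by
    obtain ⟨⟨x, hx⟩, rfl⟩ := Submodule.Quotient.mk_surjective _ x
    obtain ⟨z, hz, w, hw, rfl⟩ := Submodule.mem_sup.1 hx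
    obtain ⟨g, rfl⟩ := Submodule.mem_span_singleton.1 hw
    refine ⟨g, ((Submodule.Quotient.eq _).2 ?_).symm⟩
    change z + g • y - g • y ∈ N
    rwa [add_sub_cancel_right]
  have hker : LinearMap.ker f = P := by
    ext g
    rw [LinearMap.mem_ker, ← hann]
    exact Submodule.Quotient.mk_eq_zero _
  exact hker ▸ ⟨(f.quotKerEquivOfSurjective hf).symm⟩

theorem le_and_nonempty_quotient_equiv_iff :
    (N ≤ N' ∧ Nonempty ((N' ⧸ N.submoduleOf N') ≃ₗ[R] (R ⧸ P))) ↔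
      ∃ y, N' = N ⊔ R ∙ y ∧ ∀ g : R, g • y ∈ N ↔ g ∈ P := by
  constructor
  · rintro ⟨hle, ⟨e⟩⟩
    exact exists_eq_sup_span_of_quotient_equiv hle e
  · rintro ⟨y, rfl, hann⟩
    exact ⟨le_sup_left, nonempty_quotient_sup_span_equiv hann⟩

end CyclicQuotient

theorem setOf_minimal_mem_support_self :
    {p | Minimal (· ∈ Module.support R R) p} = {p : PrimeSpectrum R | IsMin p} := by
  have h (p : PrimeSpectrum R) : p ∈ Module.support R R := by
    rw [Module.support_of_algebra, Algebra.algebraMap_self, PrimeSpectrum.mem_zeroLocus,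
      SetLike.coe_subset_coe, (RingHom.ker_eq_bot_iff_eq_zero _).2 fun _ => id]
    exact bot_le
  simp only [h, minimal_true]

theorem isCleanRing_iff_exists_descending : IsCleanRing R ↔
    ∃ (r : ℕ) (P : Fin r → PrimeSpectrum R) (J : Fin (r + 1) → Ideal R),
      Set.range P = {p | IsMin p} ∧ J 0 = ⊤ ∧ J (Fin.last r) = ⊥ ∧
      ∀ j, ∃ y, J j.castSucc = J j.succ ⊔ R ∙ y ∧
        ∀ g, g * y ∈ J j.succ ↔ g ∈ (P j).asIdeal := by
  simp only [IsCleanRing, IsCleanModule, le_and_nonempty_quotient_equiv_iff,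
    setOf_minimal_mem_support_self, smul_eq_mul]
  constructor
  · rintro ⟨r, N, P, h0, hlast, hstep, hP⟩
    refine ⟨r, P ∘ Fin.rev, N ∘ Fin.rev, ?_, ?_, ?_, fun j => ?_⟩
    · rw [Fin.rev_surjective.range_comp, hP]
    · simpa using hlast
    · simpa using h0
    · simpa only [Function.comp_apply, Fin.rev_castSucc, Fin.rev_succ] using hstep j.rev
  · rintro ⟨r, P, J, hP, h0, hlast, hstep⟩
    refine ⟨r, J ∘ Fin.rev, P ∘ Fin.rev, ?_, ?_, fun j => ?_, ?_⟩
    · simpa using hlast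
    · simpa using h0
    · simpa only [Function.comp_apply, Fin.rev_castSucc, Fin.rev_succ] using hstep j.rev
    · rw [Fin.rev_surjective.range_comp, hP]

variable {r : ℕ} {P : Fin r → PrimeSpectrum R}

theorem iInf_asIdeal_eq_bot [IsReduced R] (hP : Set.range P = {p | IsMin p}) :
    ⨅ k, (P k).asIdeal = ⊥ := by
  rw [← Ideal.zero_eq_bot, ← nilradical_eq_zero R, nilradical, ← Ideal.sInf_minimalPrimes]
  refine le_antisymm (le_sInf fun p hp => ?_) (le_iInf fun k => sInf_le ?_)
  · obtain ⟨k, hk⟩ : (⟨p, hp.1.1⟩ : PrimeSpectrum R) ∈ Set.range P :=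
      hP ▸ PrimeSpectrum.isMin_iff.2 hp
    exact (iInf_le _ k).trans_eq (congrArg _ hk)
  · exact PrimeSpectrum.isMin_iff.1 (hP.subset (Set.mem_range_self k))

theorem exists_notMem_mul_eq_zero [IsReduced R] (hP : Set.range P = {p | IsMin p}) (j : Fin r)
    {x : R} (hx : x ∈ (P j).asIdeal) : ∃ s ∉ (P j).asIdeal, s * x = 0 := by
  classical
  have hnle : ¬ (Finset.univ.filter (P · ≠ P j)).inf (fun k => (P k).asIdeal) ≤ (P j).asIdeal := by
    rw [(P j).isPrime.inf_le']
    rintro ⟨k, hk, hkj⟩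
    have hj : IsMin (P j) := hP.subset (Set.mem_range_self j)
    exact (Finset.mem_filter.1 hk).2 (hj.eq_of_le hkj)
  obtain ⟨s, hs, hsj⟩ := SetLike.not_le_iff_exists.1 hnle
  refine ⟨s, hsj, ?_⟩
  rw [← Ideal.mem_bot, ← iInf_asIdeal_eq_bot hP, Submodule.mem_iInf]
  intro k
  by_cases hk : P k = P j
  · exact hk ▸ Ideal.mul_mem_left _ _ hx
  · exact Ideal.mul_mem_right _ _ ((Submodule.mem_finsetInf.1 hs) k (by simpa using hk))

theorem eq_iInf_of_descending [IsReduced R] (hP : Set.range P = {p | IsMin p})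
    {J : Fin (r + 1) → Ideal R} (h0 : J 0 = ⊤) {y : Fin r → R}
    (hJ : ∀ j, J j.castSucc = J j.succ ⊔ R ∙ y j)
    (hy : ∀ j g, g * y j ∈ J j.succ ↔ g ∈ (P j).asIdeal) (i : Fin (r + 1)) :
    J i = ⨅ k : Fin r, ⨅ _ : k.castSucc < i, (P k).asIdeal := by
  have hanti : Antitone J := Fin.antitone_iff_succ_le.2 fun j => hJ j ▸ le_sup_left
  refine le_antisymm (le_iInf₂ fun k hk x hx => (hy k x).1 ?_) ?_
  · exact Ideal.mul_mem_right _ _ (hanti (Fin.castSucc_lt_iff_succ_le.1 hk) hx)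
  induction i using Fin.induction with
  | zero => exact h0 ▸ le_top
  | succ j ih =>
    intro x hx
    simp only [Submodule.mem_iInf, Fin.castSucc_lt_succ_iff] at hx ih
    have hxj : x ∈ J j.castSucc := ih (by
      simpa only [Submodule.mem_iInf, Fin.castSucc_lt_castSucc_iff] using fun k hk => hx k hk.le)
    rw [hJ] at hxj
    obtain ⟨z, hz, w, hw, rfl⟩ := Submodule.mem_sup.1 hxj
    obtain ⟨g, rfl⟩ := Submodule.mem_span_singleton.1 hw
    obtain ⟨s, hs, hsx⟩ := exists_notMem_mul_eq_zero hP j (hx j le_rfl)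
    have hsg : s * g ∈ (P j).asIdeal := (hy j _).1 (by
      rw [smul_eq_mul] at hsx
      rw [show s * g * y j = -(s * z) by linear_combination hsx]
      exact neg_mem (Ideal.mul_mem_left _ _ hz))
    exact add_mem hz ((hy j g).2 (((P j).isPrime.mem_or_mem hsg).resolve_left hs))

theorem injective_of_descending [IsReduced R] (hP : Set.range P = {p | IsMin p})
    {J : Fin (r + 1) → Ideal R} {y : Fin r → R} (hJ : ∀ j, J j.castSucc = J j.succ ⊔ R ∙ y j)
    (hy : ∀ j g, g * y j ∈ J j.succ ↔ g ∈ (P j).asIdeal) : Function.Injective P := by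
  have hanti : Antitone J := Fin.antitone_iff_succ_le.2 fun j => hJ j ▸ le_sup_left
  refine Function.Injective.of_lt_imp_ne fun i j hij heq => ?_
  have hyi : y j ∈ (P i).asIdeal := (hy i _).1 (Ideal.mul_mem_right _ _
    (hanti (Fin.succ_le_castSucc_iff.2 hij)
      (hJ j ▸ Submodule.mem_sup_right (Submodule.mem_span_singleton_self _))))
  obtain ⟨s, hs, hsy⟩ := exists_notMem_mul_eq_zero hP j (heq ▸ hyi)
  exact hs ((hy j s).1 (hsy ▸ zero_mem _))

theorem mul_mem_iInf_iff (hP : ∀ k, IsMin (P k)) (hinj : Function.Injective P) {j : Fin r} {y : R}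
    (hy : ⨅ k < j, (P k).asIdeal = (⨅ k ≤ j, (P k).asIdeal) ⊔ R ∙ y) (g : R) :
    g * y ∈ ⨅ k ≤ j, (P k).asIdeal ↔ g ∈ (P j).asIdeal := by
  have hle : R ∙ y ≤ ⨅ k < j, (P k).asIdeal := hy ▸ le_sup_right
  rw [Submodule.span_singleton_le_iff_mem] at hle
  have hyj : y ∉ (P j).asIdeal := fun hyj => by
    have hlej : (Finset.Iio j).inf (fun k => (P k).asIdeal) ≤ (P j).asIdeal := by
      simp only [Finset.inf_eq_iInf, Finset.mem_Iio]
      exact hy.trans_le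
        (sup_le (biInf_le (fun k => (P k).asIdeal) (le_refl j))
          ((Submodule.span_singleton_le_iff_mem _ _).2 hyj))
    obtain ⟨k, hk, hkj⟩ := (P j).isPrime.inf_le'.1 hlej
    exact (Finset.mem_Iio.1 hk).ne (hinj ((hP j).eq_of_le hkj))
  simp only [Submodule.mem_iInf] at hle ⊢
  refine ⟨fun h => ((P j).isPrime.mem_or_mem (h j le_rfl)).resolve_right hyj, fun hg k hk => ?_⟩
  obtain rfl | hk := hk.eq_or_lt
  · exact Ideal.mul_mem_right _ _ hg
  · exact Ideal.mul_mem_left _ _ (hle k hk)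

theorem isCleanRing_iff_exists_iInf_eq_sup_span [IsReduced R] : IsCleanRing R ↔
    ∃ (r : ℕ) (P : Fin r → PrimeSpectrum R), Function.Injective P ∧
      Set.range P = {p | IsMin p} ∧
      ∀ j, ∃ y, ⨅ k < j, (P k).asIdeal = (⨅ k ≤ j, (P k).asIdeal) ⊔ R ∙ y := by
  rw [isCleanRing_iff_exists_descending]
  refine exists_congr fun r => exists_congr fun P => ⟨?_, ?_⟩
  · rintro ⟨J, hP, h0, -, hstep⟩
    choose y hJ hy using hstep
    refine ⟨injective_of_descending hP hJ hy, hP, fun j => ⟨y j, ?_⟩⟩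
    simpa only [eq_iInf_of_descending hP h0 hJ hy, Fin.castSucc_lt_castSucc_iff,
      Fin.castSucc_lt_succ_iff] using hJ j
  · rintro ⟨hinj, hP, hstep⟩
    refine ⟨fun i => ⨅ k : Fin r, ⨅ _ : k.castSucc < i, (P k).asIdeal, hP, ?_, ?_, fun j => ?_⟩
    · simp only [Fin.not_lt_zero, iInf_false, iInf_top]
    · simpa only [Fin.castSucc_lt_last, iInf_pos] using iInf_asIdeal_eq_bot hP
    · obtain ⟨y, hy⟩ := hstep j
      simp only [Fin.castSucc_lt_castSucc_iff, Fin.castSucc_lt_succ_iff]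
      exact ⟨y, hy, mul_mem_iInf_iff (fun k => hP.subset (Set.mem_range_self k)) hinj hy⟩

end CleanFiltration

/-! ### Toric face rings -/

theorem exists_eq_single_of_mul_eq_single {k G : Type*} [Semiring k] [NoZeroDivisors k] [Add G]
    [TwoUniqueSums G] {f g : AddMonoidAlgebra k G} {t : G} {r : k} (hr : r ≠ 0)
    (h : f * g = .single t r) :
    ∃ a b c e, f = .single a b ∧ g = .single c e ∧ a + c = t ∧ b * e = r := by
  -- a sum attained only once is the exponent of a monomial of `f * g`
  have eq_of_uniqueAdd {p : G × G} (hp : p ∈ f.coeff.support ×ˢ g.coeff.support)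
      (hu : UniqueAdd f.coeff.support g.coeff.support p.1 p.2) : p.1 + p.2 = t := by
    by_contra hne
    have hcoeff := AddMonoidAlgebra.coeff_mul_add_of_uniqueAdd hu
    rw [h, AddMonoidAlgebra.coeff_single, Finsupp.single_eq_of_ne hne] at hcoeff
    rw [Finset.mem_product, Finsupp.mem_support_iff, Finsupp.mem_support_iff] at hp
    exact mul_ne_zero hp.1 hp.2 hcoeff.symm
  have hcard : f.coeff.support.card * g.coeff.support.card ≤ 1 := by
    by_contra! hlt
    obtain ⟨p, hp, q, hq, hpq, hup, huq⟩ := TwoUniqueSums.uniqueAdd_of_one_lt_card hlt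
    obtain ⟨hq₁, hq₂⟩ := Finset.mem_product.1 hq
    exact hpq (Prod.ext_iff.2 ((hup hq₁ hq₂
      ((eq_of_uniqueAdd hq huq).trans (eq_of_uniqueAdd hp hup).symm)).imp Eq.symm Eq.symm))
  have hfg : f * g ≠ 0 := h ▸ AddMonoidAlgebra.single_ne_zero.2 hr
  have hpos (x : AddMonoidAlgebra k G) (hx : x ≠ 0) : 0 < x.coeff.support.card :=
    Finset.card_pos.2 (Finsupp.support_nonempty_iff.2 (AddMonoidAlgebra.coeff_eq_zero.not.2 hx))
  have hf := hpos f (left_ne_zero_of_mul hfg)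
  have hg := hpos g (right_ne_zero_of_mul hfg)
  obtain ⟨a, b, -, hfa⟩ := Finsupp.card_support_eq_one'.1
    (le_antisymm ((Nat.le_mul_of_pos_right _ hg).trans hcard) hf)
  obtain ⟨c, e, -, hgc⟩ := Finsupp.card_support_eq_one'.1
    (le_antisymm ((Nat.le_mul_of_pos_left _ hf).trans hcard) hg)
  obtain rfl : f = .single a b := AddMonoidAlgebra.coeff_injective hfa
  obtain rfl : g = .single c e := AddMonoidAlgebra.coeff_injective hgc
  rw [AddMonoidAlgebra.single_mul_single, AddMonoidAlgebra.single_inj] at h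
  obtain h | ⟨-, h⟩ := h
  · exact ⟨a, b, c, e, rfl, rfl, h⟩
  · exact (hr h).elim

namespace ToricFaceRing

variable {d : ℕ} {K : Type*} [Field K] {S : RationalPointedFan d} {C D : RCone d}

noncomputable instance : Algebra K (ToricFaceRing K S) :=
  Algebra.ofModule (fun c f g => by simp [mul_def]) (fun c f g => by simp [mul_def])

/-- The coefficient of `x^a`, taken to be `0` if `a` lies outside the support of the fan. -/
noncomputable def coeff (a : Fin d → ℤ) : ToricFaceRing K S →ₗ[K] K :=
  extend fun b => if (b : Fin d → ℤ) = a then 1 else 0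

theorem coeff_monomial (a : Fin d → ℤ) (b : S.latticePoints) :
    coeff a (monomial b : ToricFaceRing K S) = if (b : Fin d → ℤ) = a then 1 else 0 :=
  extend_monomial _ b

theorem coeff_eq_lapply (a : S.latticePoints) :
    (coeff a.1 : ToricFaceRing K S →ₗ[K] K) =
      (Finsupp.lapply a : (S.latticePoints →₀ K) →ₗ[K] K) := by
  refine hom_ext fun b => (coeff_monomial _ b).trans ?_
  change _ = Finsupp.single b (1 : K) a
  simp only [Finsupp.single_apply, Subtype.ext_iff]

theorem mem_of_forall_monomial_mem {I : Ideal (ToricFaceRing K S)} {f : ToricFaceRing K S}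
    (h : ∀ a : S.latticePoints, coeff (a : Fin d → ℤ) f ≠ 0 → monomial a ∈ I) : f ∈ I := by
  have hf : extend (K := K) monomial f = f := LinearMap.congr_fun
    (hom_ext (g := LinearMap.id) (extend_monomial monomial)) f
  rw [← hf]
  refine Submodule.sum_mem _ fun a ha => Submodule.smul_of_tower_mem I _ (h a ?_)
  rw [coeff_eq_lapply]
  exact Finsupp.mem_support_iff.1 ha

open Classical in
variable (K) in
/-- The linear map onto the monoid algebra of the lattice points of `C` that keeps the monomials
of `C` and kills the others. -/
noncomputable def restrictLin (C : RCone d) :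
    ToricFaceRing K S →ₗ[K] AddMonoidAlgebra K (Fin d → ℤ) :=
  extend fun a => if (a : Fin d → ℤ) ∈ C.latticePoints then .single a 1 else 0

open Classical in
theorem restrictLin_monomial (C : RCone d) (a : S.latticePoints) :
    restrictLin K C (monomial a) =
      if (a : Fin d → ℤ) ∈ C.latticePoints then .single (a : Fin d → ℤ) 1 else 0 :=
  extend_monomial _ a

theorem restrictLin_monomial_mul_monomial (hC : C ∈ S.cones) (a b : S.latticePoints) :
    restrictLin K C (monomial a * monomial b) =
      restrictLin K C (monomial a) * restrictLin K C (monomial b) := by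
  classical
  rw [monomial_mul_monomial]
  by_cases hab : S.InCommonCone a b
  · simp only [dif_pos hab, restrictLin_monomial, S.add_mem_latticePoints_iff hC hab]
    by_cases ha : (a : Fin d → ℤ) ∈ C.latticePoints <;>
      by_cases hb : (b : Fin d → ℤ) ∈ C.latticePoints <;>
      simp [ha, hb, AddMonoidAlgebra.single_mul_single]
  · have habC : ¬((a : Fin d → ℤ) ∈ C.latticePoints ∧ (b : Fin d → ℤ) ∈ C.latticePoints) :=
      fun h => hab ⟨C, hC, h⟩
    rw [dif_neg hab, map_zero, restrictLin_monomial, restrictLin_monomial, ite_zero_mul_ite_zero,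
      if_neg habC]

variable (K) in
/-- The projection of `K[Σ]` onto the monoid algebra of the lattice points of a cone `C` of the fan,
viewed inside the Laurent polynomials. It is multiplicative because a sum of two lattice points of
a common cone lies in `C` only if both summands do. -/
noncomputable def restrict (hC : C ∈ S.cones) :
    ToricFaceRing K S →ₐ[K] AddMonoidAlgebra K (Fin d → ℤ) :=
  AlgHom.ofLinearMap (restrictLin K C)
    (by
      have h0 : (0 : Fin d → ℤ) ∈ S.latticePoints := ⟨C, hC, C.zero_mem_latticePoints⟩
      have h1 : (1 : ToricFaceRing K S) = monomial ⟨0, h0⟩ := dif_pos h0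
      rw [h1, restrictLin_monomial, if_pos C.zero_mem_latticePoints]
      rfl)
    (fun f g => by
      have h : mulLin.compr₂ (restrictLin K C) =
          (LinearMap.mul K _).compl₁₂ (restrictLin K C) (restrictLin K C) :=
        hom_ext fun a => hom_ext fun b => restrictLin_monomial_mul_monomial (S := S) hC a b
      exact LinearMap.congr_fun₂ h f g)

open Classical in
theorem restrict_monomial (hC : C ∈ S.cones) (a : S.latticePoints) :
    restrict K hC (monomial a) =
      if (a : Fin d → ℤ) ∈ C.latticePoints then .single (a : Fin d → ℤ) 1 else 0 :=
  restrictLin_monomial C a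

open Classical in
theorem coeff_restrict (hC : C ∈ S.cones) (f : ToricFaceRing K S) (a : Fin d → ℤ) :
    (restrict K hC f).coeff a = if a ∈ C.latticePoints then coeff a f else 0 := by
  let lhs : ToricFaceRing K S →ₗ[K] K := Finsupp.lapply a ∘ₗ
    (AddMonoidAlgebra.coeffLinearEquiv K).toLinearMap ∘ₗ (restrict K hC).toLinearMap
  have h : lhs = if a ∈ C.latticePoints then coeff a else 0 := by
    refine hom_ext fun b => ?_
    change (restrict K hC (monomial b)).coeff a = _
    rw [restrict_monomial]
    split_ifs with hb ha ha
    · rw [coeff_monomial]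
      exact Finsupp.single_apply
    · exact Finsupp.single_eq_of_ne (ne_of_mem_of_not_mem hb ha).symm
    · rw [coeff_monomial, if_neg (ne_of_mem_of_not_mem ha hb).symm]
      rfl
    · rfl
  change lhs f = _
  rw [h]
  split_ifs <;> rfl

theorem mem_of_restrict_eq_single {hC : C ∈ S.cones} {f : ToricFaceRing K S} {a : Fin d → ℤ}
    {c : K} (h : restrict K hC f = .single a c) (hc : c ≠ 0) :
    a ∈ C.latticePoints ∧ coeff a f ≠ 0 := by
  classical
  have hcoeff := coeff_restrict hC f a
  rw [h, AddMonoidAlgebra.coeff_single, Finsupp.single_eq_same] at hcoeff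
  split_ifs at hcoeff with ha
  · exact ⟨ha, hcoeff ▸ hc⟩
  · exact (hc hcoeff).elim

variable (K) in
/-- The prime ideal of `K[Σ]` spanned by the monomials outside the cone `C`. -/
noncomputable def facePrime (hC : C ∈ S.cones) : PrimeSpectrum (ToricFaceRing K S) :=
  ⟨RingHom.ker (restrict K hC), RingHom.ker_isPrime _⟩

theorem mem_facePrime {hC : C ∈ S.cones} {f : ToricFaceRing K S} :
    f ∈ (facePrime K hC).asIdeal ↔ ∀ a ∈ C.latticePoints, coeff a f = 0 := by
  change restrict K hC f = 0 ↔ _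
  classical
  simp only [← AddMonoidAlgebra.coeff_inj, Finsupp.ext_iff, coeff_restrict,
    AddMonoidAlgebra.coeff_zero, Finsupp.zero_apply, ite_eq_right_iff]

theorem monomial_mem_facePrime {hC : C ∈ S.cones} {a : S.latticePoints} :
    monomial a ∈ (facePrime K hC).asIdeal ↔ (a : Fin d → ℤ) ∉ C.latticePoints := by
  simp only [mem_facePrime, coeff_monomial, ite_eq_right_iff, one_ne_zero, imp_false]
  exact ⟨fun h ha => h _ ha rfl, fun h b hb hab => h (hab ▸ hb)⟩

theorem facePrime_le_facePrime {hC : C ∈ S.cones} {hD : D ∈ S.cones} :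
    facePrime K hC ≤ facePrime K hD ↔ D ≤ C := by
  refine ⟨fun h => ?_, fun h f hf => mem_facePrime.2 fun a ha => mem_facePrime.1 hf a (h ha)⟩
  refine (RationalPointedFan.isFaceOf_of_latticePoints_subset hC hD fun a ha => ?_).le
  by_contra haC
  exact monomial_mem_facePrime.1 (h (monomial_mem_facePrime (hC := hC)
    (a := ⟨a, D, hD, ha⟩).2 haC)) ha

theorem iInf_facePrime_eq_bot : ⨅ C : S.cones, (facePrime K C.2).asIdeal = ⊥ := by
  refine eq_bot_iff.2 fun f hf => mem_of_forall_monomial_mem fun ⟨a, C, hC, ha⟩ hne => ?_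
  exact (hne (mem_facePrime.1 ((Submodule.mem_iInf _).1 hf ⟨C, hC⟩) a ha)).elim

instance : IsReduced (ToricFaceRing K S) where
  eq_zero f hf := by
    rw [← Ideal.mem_bot, ← iInf_facePrime_eq_bot, Submodule.mem_iInf]
    intro C
    obtain ⟨n, hn⟩ := hf
    exact (facePrime K C.2).isPrime.mem_of_pow_mem n (hn ▸ Submodule.zero_mem _)

theorem exists_facePrime_le (p : PrimeSpectrum (ToricFaceRing K S)) :
    ∃ (C : RCone d) (hC : C ∈ S.cones), facePrime K hC ≤ p := by
  have := S.finite.fintype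
  have hle : (Finset.univ : Finset S.cones).inf (fun C => (facePrime K C.2).asIdeal) ≤
      p.asIdeal := by
    rw [Finset.inf_univ_eq_iInf, iInf_facePrime_eq_bot]
    exact bot_le
  obtain ⟨⟨C, hC⟩, -, h⟩ := p.isPrime.inf_le'.1 hle
  exact ⟨C, hC, h⟩

theorem isMin_facePrime_iff {hC : C ∈ S.cones} :
    IsMin (facePrime K hC) ↔ Maximal (· ∈ S.cones) C := by
  refine ⟨fun h => ⟨hC, fun D hD hCD => ?_⟩, fun h p hp => ?_⟩
  · exact facePrime_le_facePrime.1 (h (facePrime_le_facePrime (hC := hD).2 hCD))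
  · obtain ⟨D, hD, hDp⟩ := exists_facePrime_le p
    refine le_trans ?_ hDp
    exact facePrime_le_facePrime.2 (h.2 hD (facePrime_le_facePrime.1 (hDp.trans hp)))

theorem exists_facePrime_eq {p : PrimeSpectrum (ToricFaceRing K S)} (hp : IsMin p) :
    ∃ (C : RCone d) (hC : C ∈ S.cones), facePrime K hC = p := by
  obtain ⟨C, hC, h⟩ := exists_facePrime_le p
  exact ⟨C, hC, hp.eq_of_le h⟩

theorem facePrime_inj {hC : C ∈ S.cones} {hD : D ∈ S.cones} :
    facePrime K hC = facePrime K hD ↔ C = D := by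
  simp only [le_antisymm_iff, facePrime_le_facePrime, and_comm]

variable {s : ℕ} {F : Fin s → RCone d}

theorem isFacetOrdering_iff_range_facePrime_eq (hF : ∀ k, F k ∈ S.cones) :
    IsFacetOrdering S.cones F ↔ Function.Injective (fun k => facePrime K (hF k)) ∧
      Set.range (fun k => facePrime K (hF k)) = {p | IsMin p} := by
  refine and_congr ?_ ⟨fun h => ?_, fun h D => ?_⟩
  · simp only [Function.Injective, facePrime_inj]
  · refine Set.Subset.antisymm ?_ fun p hp => ?_
    · rintro _ ⟨k, rfl⟩
      exact isMin_facePrime_iff.2 ((h _).1 ⟨k, rfl⟩)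
    · obtain ⟨C, hC, rfl⟩ := exists_facePrime_eq hp
      obtain ⟨k, rfl⟩ := (h C).2 (isMin_facePrime_iff.1 hp)
      exact ⟨k, rfl⟩
  · refine ⟨?_, fun hD => ?_⟩
    · rintro ⟨k, rfl⟩
      exact isMin_facePrime_iff.1 (h.subset ⟨k, rfl⟩)
    · obtain ⟨k, hk⟩ := h.superset (isMin_facePrime_iff (K := K) (hC := hD.prop).2 hD)
      exact ⟨k, facePrime_inj.1 hk⟩

variable {j : Fin s} {γ : Fin d → ℤ}

theorem monomial_mem_iInf_facePrime (hF : ∀ k, F k ∈ S.cones) (γ : S.latticePoints) :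
    monomial γ ∈ ⨅ k < j, (facePrime K (hF k)).asIdeal ↔
      ∀ k < j, (γ : Fin d → ℤ) ∉ (F k).latticePoints := by
  simp only [Submodule.mem_iInf, monomial_mem_facePrime]

theorem iInf_facePrime_eq_sup_span (hF : ∀ k, F k ∈ S.cones) (hγS : γ ∈ S.latticePoints)
    (h : newPoints F j = (γ + ·) '' (F j).latticePoints) :
    ⨅ k < j, (facePrime K (hF k)).asIdeal = (⨅ k ≤ j, (facePrime K (hF k)).asIdeal) ⊔
      ToricFaceRing K S ∙ (monomial ⟨γ, hγS⟩ : ToricFaceRing K S) := by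
  have hγ := mem_of_newPoints_eq h
  refine le_antisymm (fun f hf => mem_of_forall_monomial_mem fun a ha => ?_) (sup_le ?_ ?_)
  · have haF : ∀ k < j, (a : Fin d → ℤ) ∉ (F k).latticePoints := fun k hk hak => by
      simp only [Submodule.mem_iInf] at hf
      exact ha (mem_facePrime.1 (hf k hk) a hak)
    by_cases haj : (a : Fin d → ℤ) ∈ (F j).latticePoints
    · obtain ⟨m, hm, hma⟩ := h.subset ⟨haj, haF⟩
      have hmul : (monomial ⟨m, F j, hF j, hm⟩ * monomial ⟨γ, hγS⟩ : ToricFaceRing K S) =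
          monomial a := by
        rw [monomial_mul_monomial, dif_pos ⟨F j, hF j, hm, hγ.1⟩]
        exact congrArg monomial (Subtype.ext ((add_comm _ _).trans hma))
      exact Submodule.mem_sup_right (hmul ▸ Ideal.mul_mem_left _ _
        (Submodule.mem_span_singleton_self _))
    · refine Submodule.mem_sup_left ?_
      simp only [Submodule.mem_iInf, monomial_mem_facePrime]
      exact fun k hk => hk.lt_or_eq.elim (haF k) fun hkj => hkj ▸ haj
  · exact biInf_mono fun k hk => hk.le
  · rw [Submodule.span_singleton_le_iff_mem]
    exact (monomial_mem_iInf_facePrime hF _).2 hγ.2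

theorem exists_restrict_eq_single (hF : ∀ k, F k ∈ S.cones) {y : ToricFaceRing K S}
    (h : ⨅ k < j, (facePrime K (hF k)).asIdeal =
      (⨅ k ≤ j, (facePrime K (hF k)).asIdeal) ⊔ ToricFaceRing K S ∙ y)
    {t : Fin d → ℤ} (ht : t ∈ newPoints F j) :
    ∃ γ c, c ≠ 0 ∧ restrict K (hF j) y = .single γ c ∧
      ∃ m ∈ (F j).latticePoints, γ + m = t := by
  have hmem : monomial ⟨t, F j, hF j, ht.1⟩ ∈ ⨅ k < j, (facePrime K (hF k)).asIdeal :=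
    (monomial_mem_iInf_facePrime hF _).2 ht.2
  obtain ⟨z, hz, w, hw, hzw⟩ := Submodule.mem_sup.1 (h ▸ hmem)
  obtain ⟨g, rfl⟩ := Submodule.mem_span_singleton.1 hw
  have hz0 : restrict K (hF j) z = 0 :=
    biInf_le (fun k => (facePrime K (hF k)).asIdeal) (le_refl j) hz
  have hmul : restrict K (hF j) g * restrict K (hF j) y = .single t 1 := by
    have hrestrict := congrArg (restrict K (hF j)) hzw
    classical
    rwa [map_add, hz0, zero_add, smul_eq_mul, map_mul, restrict_monomial, if_pos ht.1]
      at hrestrict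
  obtain ⟨m, b, γ, c, hg, hy, hmγ, hbc⟩ := exists_eq_single_of_mul_eq_single one_ne_zero hmul
  exact ⟨γ, c, right_ne_zero_of_mul_eq_one hbc, hy, m,
    (mem_of_restrict_eq_single hg (left_ne_zero_of_mul_eq_one hbc)).1, (add_comm γ m).trans hmγ⟩

theorem newPoints_eq_of_iInf_facePrime_eq_sup_span (hF : IsFacetOrdering S.cones F)
    (hFS : ∀ k, F k ∈ S.cones) {y : ToricFaceRing K S}
    (h : ⨅ k < j, (facePrime K (hFS k)).asIdeal =
      (⨅ k ≤ j, (facePrime K (hFS k)).asIdeal) ⊔ ToricFaceRing K S ∙ y) :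
    ∃ γ, newPoints F j = (γ + ·) '' (F j).latticePoints := by
  obtain ⟨t, ht⟩ := RationalPointedFan.newPoints_nonempty hF j
  obtain ⟨γ, c, hc, hy, -⟩ := exists_restrict_eq_single hFS h ht
  obtain ⟨hγj, hγy⟩ := mem_of_restrict_eq_single hy hc
  have hγ : γ ∈ newPoints F j := by
    have hyk : y ∈ ⨅ k < j, (facePrime K (hFS k)).asIdeal :=
      h ▸ Submodule.mem_sup_right (Submodule.mem_span_singleton_self y)
    simp only [Submodule.mem_iInf] at hyk
    exact ⟨hγj, fun k hk hγk => hγy (mem_facePrime.1 (hyk k hk) γ hγk)⟩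
  refine ⟨γ, Set.Subset.antisymm (fun t ht => ?_) ?_⟩
  · obtain ⟨γ', c', -, hy', m, hm, hγm⟩ := exists_restrict_eq_single hFS h ht
    obtain ⟨rfl, -⟩ | ⟨hc0, -⟩ := AddMonoidAlgebra.single_inj.1 (hy.symm.trans hy')
    · exact ⟨m, hm, hγm⟩
    · exact (hc hc0).elim
  · rintro _ ⟨m, hm, rfl⟩
    exact RationalPointedFan.add_mem_newPoints hFS hγ hm

theorem exists_iInf_facePrime_eq_sup_span_iff (hF : IsFacetOrdering S.cones F)
    (hFS : ∀ k, F k ∈ S.cones) :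
    (∃ y, ⨅ k < j, (facePrime K (hFS k)).asIdeal =
      (⨅ k ≤ j, (facePrime K (hFS k)).asIdeal) ⊔ ToricFaceRing K S ∙ y) ↔
    ∃ γ, newPoints F j = (γ + ·) '' (F j).latticePoints :=
  ⟨fun ⟨_, hy⟩ => newPoints_eq_of_iInf_facePrime_eq_sup_span hF hFS hy, fun ⟨_, hγ⟩ =>
    ⟨_, iInf_facePrime_eq_sup_span hFS ⟨F j, hFS j, (mem_of_newPoints_eq hγ).1⟩ hγ⟩⟩

variable (K S) in
theorem isCleanRing_iff_exists_newPoints_eq : IsCleanRing (ToricFaceRing K S) ↔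
    ∃ (s : ℕ) (F : Fin s → RCone d), IsFacetOrdering S.cones F ∧
      ∀ j, ∃ γ, newPoints F j = (γ + ·) '' (F j).latticePoints := by
  rw [isCleanRing_iff_exists_iInf_eq_sup_span]
  refine exists_congr fun s => ⟨?_, ?_⟩
  · rintro ⟨P, hinj, hP, hstep⟩
    choose F hFS hFP using fun k => exists_facePrime_eq (hP.subset (Set.mem_range_self k))
    obtain rfl : (fun k => facePrime K (hFS k)) = P := funext hFP
    have hF := (isFacetOrdering_iff_range_facePrime_eq hFS).2 ⟨hinj, hP⟩
    exact ⟨F, hF, fun j => (exists_iInf_facePrime_eq_sup_span_iff hF hFS).1 (hstep j)⟩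
  · rintro ⟨F, hF, hγ⟩
    have hFS k : F k ∈ S.cones := ((hF.2 _).1 ⟨k, rfl⟩).prop
    obtain ⟨hinj, hP⟩ := (isFacetOrdering_iff_range_facePrime_eq (K := K) hFS).1 hF
    exact ⟨_, hinj, hP, fun j => (exists_iInf_facePrime_eq_sup_span_iff hF hFS).2 (hγ j)⟩

end ToricFaceRing

theorem theorem5p9 {d : ℕ} (S : RationalPointedFan d)
    (K : Type*) [Field K] (L : Type*) [Field L] :
    (IsCleanRing (ToricFaceRing K S) ↔
      ∃ (s : ℕ) (C : Fin s → RCone d),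
        IsShelling S.cones C ∧
        ∀ j : Fin s, 0 < (j : ℕ) →
          ∃ γ ∈ (C j).latticePoints,
            latticeStar (C j).fan γ = ((C j).fan \ (⋃ i : Fin s, ⋃ _ : i < j, (C i).fan)) ∧
            (⋃ D ∈ latticeStar (C j).fan γ, D.relintLatticePoints) =
              (fun a => γ + a) '' (C j).latticePoints) ∧
    (IsCleanRing (ToricFaceRing K S) ↔ IsCleanRing (ToricFaceRing L S)) := by
  have hK := ToricFaceRing.isCleanRing_iff_exists_newPoints_eq K S
  have hL := ToricFaceRing.isCleanRing_iff_exists_newPoints_eq L S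
  exact ⟨hK.trans RationalPointedFan.exists_newPoints_eq_iff_exists_isShelling, hK.trans hL.symm⟩
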